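/- Let $\mathbb{D}=\{z\in\mathbb{C}:|z|<1\}$ and $dA=\frac{dx\,dy}{\pi}$. A radial weight is a nonnegative function $\omega$ on $\mathbb{D}$, integrable with respect to $dA$, with $\omega(z)=\omega(|z|)$; put $\widehat{\omega}(r)=\int_r^1\omega(s)\,ds$ for $0\le r<1$ and $\widehat\omega(z)=\widehat\omega(|z|)$ for $z\in\mathbb{D}$. Write $\omega\in\widehat{\mathcal{D}}$ if $\omega$ is a radial weight for which there is $C<\infty$ with $\widehat{\omega}(r)\le C\,\widehat{\omega}\left(\frac{1+r}{2}\right)$ for all $0\le r<1$. For $0<p<\infty$, $A^p_\omega$ is the space of analytic functions $f$ on $\mathbb{D}$ with $\|f\|_{A^p_\omega}^p=\int_{\mathbb{D}}|f|^p\omega\,dA<\infty$. For an analytic map $\varphi:\mathbb{D}\to\mathbb{D}$ let $C_\varphi f=f\circ\varphi$ and $\|C_\varphi\|=\sup\{\|f\circ\varphi\|_{A^p_\omega}:f\in A^p_\omega,\ \|f\|_{A^p_\omega}\le1\}$. For $t\in[0,1)$ let $\varphi_t(z)=\frac{t-z}{1-tz}$. Let $0<p<\infty$ and let $\omega\in\widehat{\mathcal{D}}$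 not vanish almost everywhere. Then for each analytic $\varphi:\mathbb{D}\to\mathbb{D}$ the operator $C_\varphi:A^p_\omega\to A^p_\omega$ is bounded, and there exists $c=c(\omega,p)>0$ such that $$\frac{c}{\widehat{\omega}(\varphi(0))(1-|\varphi(0)|)}\le\|C_\varphi\|^p$$ for all analytic $\varphi:\mathbb{D}\to\mathbb{D}$. Moreover, there exists $C=C(\omega,p)>0$ such that $$\|C_\varphi\|^p\le\frac{C}{\widehat{\omega}(\varphi(0))(1-|\varphi(0)|)}$$ for all analytic $\varphi:\mathbb{D}\to\mathbb{D}$ if and only if there exists $M=M(\omega)>0$ such that $$\widehat{\omega}(\varphi_t(r))\le M\,\frac{\widehat{\omega}(t)}{\widehat{\omega}(r)},\qquad 0\le r\le t<1.$$ -/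

import Mathlib

open MeasureTheory Metric Set
open scoped ENNReal NNReal

noncomputable section

/-- The normalized area measure `dA = dx dy / π` on the unit disc. -/
def discArea : Measure ℂ :=
  ENNReal.ofReal Real.pi⁻¹ • (volume.restrict (ball (0 : ℂ) 1))

/-- A radial weight: a nonnegative integrable function on the unit disc with `ω(z) = ω(|z|)`.
The values of `ω` outside the disc play no role. -/
structure IsRadialWeight (ω : ℂ → ℝ) : Prop where
  nonneg : ∀ z ∈ ball (0 : ℂ) 1, 0 ≤ ω z
  integrable : Integrable ω discArea
  radial : ∀ z ∈ ball (0 : ℂ) 1, ω z = ω ((‖z‖ : ℝ) : ℂ)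

/-- The tail integral `ω̂(r) = ∫_r^1 ω(s) ds`, with values in `[0, ∞]`. It is finite for `r > 0` when
`ω` is a radial weight, and also for `r = 0` when `ω` has the doubling property below. -/
def radialTail (ω : ℂ → ℝ) (r : ℝ) : ℝ≥0∞ :=
  ∫⁻ s in Ioo r 1, ENNReal.ofReal (ω (s : ℂ))

/-- The class of radial weights with `ω̂(r) ≤ C ω̂((1 + r) / 2)` for all `0 ≤ r < 1`. -/
structure InDHat (ω : ℂ → ℝ) : Prop extends IsRadialWeight ω where
  doubling : ∃ C : ℝ≥0, ∀ r : ℝ, 0 ≤ r → r < 1 →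
    radialTail ω r ≤ C * radialTail ω ((1 + r) / 2)

/-- The measure `ω dA` on the unit disc. -/
def weightMeasure (ω : ℂ → ℝ) : Measure ℂ :=
  discArea.withDensity (fun z => ENNReal.ofReal (ω z))

/-- The (quasi-)norm `‖f‖ = (∫_𝔻 |f|^p ω dA)^(1/p)`. -/
def bergmanNorm (p : ℝ) (ω : ℂ → ℝ) (f : ℂ → ℂ) : ℝ≥0∞ :=
  eLpNorm f (ENNReal.ofReal p) (weightMeasure ω)

/-- The weighted Bergman space `A^p_ω`: analytic functions on the unit disc with finite norm. -/
def bergmanSpace (p : ℝ) (ω : ℂ → ℝ) : Set (ℂ → ℂ) :=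
  {f | DifferentiableOn ℂ f (ball (0 : ℂ) 1) ∧ bergmanNorm p ω f < ∞}

/-- Analytic self-maps of the unit disc. -/
def IsAnalyticSelfMap (φ : ℂ → ℂ) : Prop :=
  DifferentiableOn ℂ φ (ball (0 : ℂ) 1) ∧ MapsTo φ (ball (0 : ℂ) 1) (ball (0 : ℂ) 1)

/-- `C_φ f = f ∘ φ` maps `A^p_ω` to itself and is a bounded operator there. -/
def CompBounded (p : ℝ) (ω : ℂ → ℝ) (φ : ℂ → ℂ) : Prop :=
  (∀ f ∈ bergmanSpace p ω, f ∘ φ ∈ bergmanSpace p ω) ∧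
  ∃ K : ℝ≥0, ∀ f ∈ bergmanSpace p ω, bergmanNorm p ω (f ∘ φ) ≤ K * bergmanNorm p ω f

/-- The operator norm of `C_φ` on `A^p_ω`: the supremum of `‖f ∘ φ‖` over the closed unit ball. -/
def compOpNorm (p : ℝ) (ω : ℂ → ℝ) (φ : ℂ → ℂ) : ℝ≥0∞ :=
  ⨆ (f : ℂ → ℂ) (_ : f ∈ bergmanSpace p ω) (_ : bergmanNorm p ω f ≤ 1), bergmanNorm p ω (f ∘ φ)

/-- The disc automorphism `φ_a(z) = (a - z) / (1 - ā z)`. -/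
def discAut (a z : ℂ) : ℂ := (a - z) / (1 - (starRingEnd ℂ) a * z)

end

/-! Everything is reduced to the behaviour of ω̂. Write M(f, r) for the mean of |f|^p over |z| = r
(`powerMean`). In polar coordinates ‖f‖^p is the integral of 2r M(f, r) against ω(r) dr
(`bergmanNorm_rpow`).

Upper bounds. Put a = |φ(0)|. Littlewood subordination and Schwarz–Pick give M(f ∘ φ, r) ≤ 4/(1-a) ·
M(f, ρ(r)), where ρ(r) is the pseudohyperbolic sum of a and (1+r)/2 (`powerMean_comp_le`). Since
M(f, ·) is increasing, the layer-cake formula turns the estimate of the integral of M(f, ρ(r)) into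
a comparison of tails: if ω̂((x-a)/(1-ax)) ≤ D ω̂(x) for all x, with negative arguments read as 0,
then ‖C_φ‖^p ≤ const · D/(1-a) (`bergmanNorm_comp_rpow_le`). Doubling always yields such a D
depending on a, hence boundedness. The condition on ω̂(φ_t(r)) with r = a, t = x says that D may be
taken comparable to 1/ω̂(a), which is the sharp upper bound.

Lower bounds. For n large, f_a(z) = ((1-a)/(1-az))^n satisfies ‖f_a‖^p ≤ const · (1-a) ω̂(a)
(`bergmanNorm_testFunction_rpow_le`). With a = |φ(0)| and after a rotation, |f_a ∘ φ| is at least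
2^(-n) at the origin, which bounds ‖f_a ∘ φ‖ from below and gives the universal lower estimate.

Necessity. Apply C_φ with φ = φ_r to f_t. With s = φ_t(r), the function f_t ∘ φ_r is bounded below
on a box of size 1-s at -1, so ‖f_t ∘ φ_r‖^p ≥ const · (1-s) ω̂(s). Since 1-s ≥ (1-t)/(1-r), the
assumed bound on ‖C_φ‖ leaves exactly ω̂(s) ≤ M ω̂(t)/ω̂(r). -/

section

open Real Filter Topology

/-! ### Littlewood subordination for p-means on circles -/

/-- A holomorphic function composed with a self-map: comparison of the means of `‖h‖`. -/
theorem circleAverage_norm_comp_le {h φ : ℂ → ℂ} {r R : ℝ} (hr : 0 ≤ r)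
    (hh : DiffContOnCl ℂ h (ball 0 R)) (hφ : DifferentiableOn ℂ φ (closedBall 0 r))
    (hmaps : MapsTo φ (closedBall 0 r) (ball 0 R)) :
    circleAverage (fun z => ‖h (φ z)‖) 0 r ≤
      (R + ‖φ 0‖) / (R - ‖φ 0‖) * circleAverage (fun z => ‖h z‖) 0 R := by
  have h0 : φ 0 ∈ ball (0 : ℂ) R := hmaps (by simpa using hr)
  have hR : 0 < R := pos_of_mem_ball h0
  have hcs : ContinuousOn h (sphere 0 R) :=
    hh.2.mono (by rw [closure_ball _ hR.ne']; exact sphere_subset_closedBall)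
  have hint : CircleIntegrable (fun z => ‖h z‖) 0 R := (hcs.norm).circleIntegrable hR.le
  have hint' : CircleIntegrable (fun z => ((‖h z‖ : ℝ) : ℂ)) 0 R :=
    (Complex.continuous_ofReal.comp_continuousOn hcs.norm).circleIntegrable hR.le
  have hker : ∀ w ∈ ball (0 : ℂ) R,
      ContinuousOn (Complex.re ∘ herglotzRieszKernel 0 w) (sphere 0 R) := fun w hw =>
    Complex.continuous_re.comp_continuousOn
      (by simpa [abs_of_pos hR] using continuousOn_herglotzRieszKernel_sphere hw)
  have hker0 : ∀ w ∈ ball (0 : ℂ) R, ∀ z ∈ sphere (0 : ℂ) R,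
      0 ≤ (herglotzRieszKernel 0 w z).re := by
    intro w hw z hz
    have h1 := le_re_herglotzRieszKernel hz hw
    rw [herglotzRieszKernel_def]
    refine le_trans ?_ h1
    have : ‖w‖ < R := by simpa using hw
    have h3 := norm_nonneg w
    simp only [sub_zero]
    exact div_nonneg (by linarith) (by linarith)
  -- The real part of `U` is the Poisson integral of |h|, which dominates |h|. Since `U` is
  -- holomorphic, so is `U ∘ φ`, and its mean over the circle is `U (φ 0)`; the Poisson kernel at `φ
  -- 0` is at most (R+|φ(0)|)/(R-|φ(0)|).
  let U : ℂ → ℂ := fun w =>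
    circleAverage (fun ζ => herglotzRieszKernel 0 w ζ • ((‖h ζ‖ : ℝ) : ℂ)) 0 R
  have hU : DifferentiableOn ℂ U (ball 0 R) :=
    differentiableOn_circleAverage_herglotzRieszKernel_smul hint'
  have hUre : ∀ w ∈ ball (0 : ℂ) R, (U w).re =
      circleAverage ((Complex.re ∘ herglotzRieszKernel 0 w) • fun z => ‖h z‖) 0 R := fun w hw =>
    re_circleAverage_herglotzRieszKernel_smul hint hw
  have hle : ∀ w ∈ ball (0 : ℂ) R, ‖h w‖ ≤ (U w).re := by
    intro w hw
    rw [hUre w hw, ← hh.circleAverage_re_herglotzRieszKernel_smul hw, circleAverage_def,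
      circleAverage_def, norm_smul, Real.norm_of_nonneg (by positivity), smul_eq_mul]
    gcongr
    refine (intervalIntegral.norm_integral_le_integral_norm (by positivity)).trans_eq ?_
    refine intervalIntegral.integral_congr fun θ _ => ?_
    simp only [Pi.smul_apply', Function.comp_apply, norm_smul, smul_eq_mul]
    rw [Real.norm_of_nonneg (hker0 w hw _ (circleMap_mem_sphere 0 hR.le θ))]
  have hcomp : DifferentiableOn ℂ (U ∘ φ) (closedBall 0 r) := hU.comp hφ hmaps
  have hcomp' : DiffContOnCl ℂ (U ∘ φ) (ball 0 |r|) := by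
    rw [abs_of_nonneg hr]
    exact (hcomp.mono closure_ball_subset_closedBall).diffContOnCl
  have hrs : sphere (0 : ℂ) |r| ⊆ closedBall 0 r := by
    rw [abs_of_nonneg hr]; exact sphere_subset_closedBall
  have hintU : CircleIntegrable (U ∘ φ) 0 r :=
    (hcomp.continuousOn.mono hrs).circleIntegrable'
  calc circleAverage (fun z => ‖h (φ z)‖) 0 r
      ≤ circleAverage (Complex.reCLM ∘ (U ∘ φ)) 0 r := by
        refine circleAverage_mono ?_ ?_ ?_
        · refine ContinuousOn.circleIntegrable' ?_
          exact (hh.1.continuousOn.comp (hφ.continuousOn.mono hrs)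
            (hmaps.mono_left hrs)).norm
        · exact ((Complex.continuous_re.comp_continuousOn
            hcomp.continuousOn).mono hrs).circleIntegrable'
        · intro z hz
          exact hle _ (hmaps (hrs hz))
    _ = (U (φ 0)).re := by
        rw [Complex.reCLM.circleAverage_comp_comm hintU, hcomp'.circleAverage]; rfl
    _ = circleAverage ((Complex.re ∘ herglotzRieszKernel 0 (φ 0)) • fun z => ‖h z‖) 0 R :=
        hUre _ h0
    _ ≤ circleAverage (((R + ‖φ 0‖) / (R - ‖φ 0‖)) • fun z => ‖h z‖) 0 R := by
        have hR' : sphere (0 : ℂ) |R| = sphere 0 R := by rw [abs_of_pos hR]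
        refine circleAverage_mono ?_ ?_ ?_
        · exact ((hker _ h0).smul hcs.norm).circleIntegrable hR.le
        · exact (hcs.norm.const_smul _).circleIntegrable hR.le
        · intro z hz
          rw [hR'] at hz
          simp only [Pi.smul_apply', Pi.smul_apply, Function.comp_apply, smul_eq_mul]
          gcongr
          simpa [herglotzRieszKernel_def] using re_herglotzRieszKernel_le hz h0
    _ = _ := by rw [circleAverage_smul, smul_eq_mul]

/-- The comparison of means for powers of the modulus of a zero-free function. -/
theorem circleAverage_norm_rpow_comp_le_of_ne_zero {g φ : ℂ → ℂ} {p r R : ℝ} (hp : 0 < p)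
    (hr : 0 ≤ r) (hg : DifferentiableOn ℂ g (ball 0 R)) (hgc : ContinuousOn g (closedBall 0 R))
    (hg0 : ∀ z ∈ ball 0 R, g z ≠ 0) (hφ : DifferentiableOn ℂ φ (closedBall 0 r))
    (hmaps : MapsTo φ (closedBall 0 r) (ball 0 R)) :
    circleAverage (fun z => ‖g (φ z)‖ ^ p) 0 r ≤
      (R + ‖φ 0‖) / (R - ‖φ 0‖) * circleAverage (fun z => ‖g z‖ ^ p) 0 R := by
  have h0 : φ 0 ∈ ball (0 : ℂ) R := hmaps (by simpa using hr)
  have hR : 0 < R := pos_of_mem_ball h0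
  have hφ0 : ‖φ 0‖ < R := by simpa using h0
  obtain ⟨F, hF, hFre⟩ := InnerProductSpace.HarmonicOnNhd.exists_analyticOnNhd_ball_re_eq
    (f := fun z => Real.log ‖g z‖) (z := 0) (R := R)
    (fun z hz => ((hg.analyticOnNhd isOpen_ball) z hz).harmonicAt_log_norm (hg0 z hz))
  -- A branch of g^p, which exists because log|g| is harmonic and hence the real part of a
  -- holomorphic `F`.
  let h : ℂ → ℂ := fun z => Complex.exp (p * F z)
  have hnorm : ∀ z ∈ ball (0 : ℂ) R, ‖h z‖ = ‖g z‖ ^ p := by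
    intro z hz
    have := hFre hz
    simp only at this
    simp only [h, Complex.norm_exp, Complex.re_ofReal_mul, this]
    rw [Real.rpow_def_of_pos (norm_pos_iff.2 (hg0 z hz)), mul_comm]
  have hh : DifferentiableOn ℂ h (ball 0 R) :=
    ((hF.differentiableOn).const_mul (p : ℂ)).cexp
  obtain ⟨ρ, hρR, hρ⟩ : ∃ ρ < R, ∀ z ∈ closedBall (0 : ℂ) r, ‖φ z‖ ≤ ρ := by
    obtain ⟨z₀, hz₀, hmax⟩ := (isCompact_closedBall (0 : ℂ) r).exists_isMaxOn
      ⟨0, by simpa using hr⟩ hφ.continuousOn.norm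
    exact ⟨‖φ z₀‖, by simpa using hmaps hz₀, fun z hz => hmax hz⟩
  have hρ0 : ‖φ 0‖ ≤ ρ := hρ 0 (by simpa using hr)
  -- `g` may vanish on the circle of radius `R`, so `h` is controlled only inside; the estimate is
  -- proved on smaller circles still enclosing the image of φ, and R' tends to R.
  have key : ∀ R' ∈ Ioo ρ R, circleAverage (fun z => ‖g (φ z)‖ ^ p) 0 r ≤
      (R' + ‖φ 0‖) / (R' - ‖φ 0‖) * circleAverage (fun z => ‖g z‖ ^ p) 0 R' := by
    intro R' hR'
    have hR'0 : 0 < R' := by linarith [hR'.1, norm_nonneg (φ 0)]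
    have hmaps' : MapsTo φ (closedBall 0 r) (ball 0 R') := fun z hz => by
      simpa using (hρ z hz).trans_lt hR'.1
    have := circleAverage_norm_comp_le (h := h) hr
      ((hh.mono ((closure_ball_subset_closedBall).trans
        (closedBall_subset_ball hR'.2))).diffContOnCl) hφ hmaps'
    rw [circleAverage_congr_sphere (f₁ := fun z => ‖h z‖) (f₂ := fun z => ‖g z‖ ^ p) (R := R')
      (fun z hz => hnorm z ?_), circleAverage_congr_sphere (f₁ := fun z => ‖h (φ z)‖)
      (f₂ := fun z => ‖g (φ z)‖ ^ p) (R := r) (fun z hz => hnorm _ (hmaps ?_))] at this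
    · exact this
    · rw [abs_of_nonneg hr] at hz; exact sphere_subset_closedBall hz
    · rw [abs_of_pos hR'0] at hz
      exact closedBall_subset_ball hR'.2 (sphere_subset_closedBall hz)
  have hcont : ContinuousOn (circleAverage (fun z => ‖g z‖ ^ p) 0) (Icc 0 R) := by
    refine ContinuousOn.circleAverage ?_ fun x hx => hx.1
    refine (hgc.norm.rpow_const fun x _ => Or.inr hp.le).mono fun z hz => ?_
    simpa using hz.2
  have hlim : Tendsto (fun R' => (R' + ‖φ 0‖) / (R' - ‖φ 0‖) *
      circleAverage (fun z => ‖g z‖ ^ p) 0 R') (𝓝[<] R)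
      (𝓝 ((R + ‖φ 0‖) / (R - ‖φ 0‖) * circleAverage (fun z => ‖g z‖ ^ p) 0 R)) := by
    refine Tendsto.mul ?_ ?_
    · refine (ContinuousAt.tendsto ?_).mono_left nhdsWithin_le_nhds
      refine ContinuousAt.div (by fun_prop) (by fun_prop) (by linarith)
    · have := (hcont R ⟨hR.le, le_rfl⟩).tendsto
      exact this.mono_left (nhdsWithin_le_of_mem
        (mem_of_superset (Ioo_mem_nhdsLT hR) Ioo_subset_Icc_self))
  exact ge_of_tendsto hlim (mem_of_superset (Ioo_mem_nhdsLT hρR) key)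

/-- The right side is zero on |z| = R and positive inside when |u| < R: this is why reflecting a
root in the circle keeps the modulus there and raises it inside. -/
theorem normSq_reflection_sub (R : ℝ) (u z : ℂ) :
    ‖(R : ℂ) ^ 2 - (starRingEnd ℂ) u * z‖ ^ 2 - R ^ 2 * ‖z - u‖ ^ 2 =
      (R ^ 2 - ‖z‖ ^ 2) * (R ^ 2 - ‖u‖ ^ 2) := by
  simp only [← Complex.normSq_eq_norm_sq]
  simp only [Complex.normSq_apply, Complex.sub_re, Complex.sub_im,
    Complex.mul_re, Complex.mul_im, Complex.conj_re, Complex.conj_im, pow_two, Complex.ofReal_re,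
    Complex.ofReal_im]
  ring

/-- A linear factor is dominated in the disc by a zero-free function of equal modulus on the
circle. -/
theorem exists_zeroFree_majorant_linear {R : ℝ} (hR : 0 < R) (u : ℂ) :
    ∃ g : ℂ → ℂ, Differentiable ℂ g ∧ (∀ z ∈ ball (0 : ℂ) R, g z ≠ 0) ∧
      (∀ z ∈ closedBall (0 : ℂ) R, ‖z - u‖ ≤ ‖g z‖) ∧ ∀ z ∈ sphere (0 : ℂ) R, ‖g z‖ = ‖z - u‖ := by
  by_cases hu : ‖u‖ < R
  · have hn : ∀ z, ‖((R : ℂ) ^ 2 - (starRingEnd ℂ) u * z) / R‖ ^ 2 - ‖z - u‖ ^ 2 =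
        (R ^ 2 - ‖z‖ ^ 2) * (R ^ 2 - ‖u‖ ^ 2) / R ^ 2 := by
      intro z
      rw [← normSq_reflection_sub, norm_div, Complex.norm_real, Real.norm_of_nonneg hR.le]
      field_simp
    have hu2 : 0 < R ^ 2 - ‖u‖ ^ 2 := by nlinarith [norm_nonneg u]
    refine ⟨fun z => ((R : ℂ) ^ 2 - (starRingEnd ℂ) u * z) / R, by fun_prop, ?_, ?_, ?_⟩
    · intro z hz h0
      have h1 := hn z
      have hz' : ‖z‖ < R := by simpa using hz
      have h2 : 0 < (R ^ 2 - ‖z‖ ^ 2) * (R ^ 2 - ‖u‖ ^ 2) / R ^ 2 := by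
        have : 0 < R ^ 2 - ‖z‖ ^ 2 := by nlinarith [norm_nonneg z]
        positivity
      simp only at h0
      rw [h0, norm_zero] at h1
      nlinarith [sq_nonneg ‖z - u‖]
    · intro z hz
      have hz' : ‖z‖ ≤ R := by simpa using hz
      have h2 : 0 ≤ (R ^ 2 - ‖z‖ ^ 2) * (R ^ 2 - ‖u‖ ^ 2) / R ^ 2 := by
        have : 0 ≤ R ^ 2 - ‖z‖ ^ 2 := by nlinarith [norm_nonneg z]
        positivity
      exact le_of_sq_le_sq (by linarith [hn z]) (norm_nonneg _)
    · intro z hz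
      have hz' : ‖z‖ = R := by simpa using hz
      have h1 := hn z
      rw [hz', sub_self, zero_mul, zero_div, sub_eq_zero] at h1
      exact (sq_eq_sq₀ (norm_nonneg _) (norm_nonneg _)).1 h1
  -- A root on or outside the circle is harmless: the factor has no zero in the open disc.
  · refine ⟨fun z => z - u, by fun_prop, ?_, fun z _ => le_rfl, fun z _ => rfl⟩
    intro z hz h0
    have hz' : ‖z‖ < R := by simpa using hz
    rw [sub_eq_zero.1 h0] at hz'
    exact hu hz'

/-- Every root inside the disc is reflected in the circle, the finite analogue of dividing by a
Blaschke product. -/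
theorem exists_zeroFree_majorant_polynomial {R : ℝ} (hR : 0 < R) {P : Polynomial ℂ} (hP : P ≠ 0) :
    ∃ g : ℂ → ℂ, Differentiable ℂ g ∧ (∀ z ∈ ball (0 : ℂ) R, g z ≠ 0) ∧
      (∀ z ∈ closedBall (0 : ℂ) R, ‖P.eval z‖ ≤ ‖g z‖) ∧
      ∀ z ∈ sphere (0 : ℂ) R, ‖g z‖ = ‖P.eval z‖ := by
  have key : ∀ s : Multiset ℂ, ∃ g : ℂ → ℂ, Differentiable ℂ g ∧ (∀ z ∈ ball (0 : ℂ) R, g z ≠ 0) ∧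
      (∀ z ∈ closedBall (0 : ℂ) R, ‖(s.map fun u => z - u).prod‖ ≤ ‖g z‖) ∧
      ∀ z ∈ sphere (0 : ℂ) R, ‖g z‖ = ‖(s.map fun u => z - u).prod‖ := by
    intro s
    induction s using Multiset.induction with
    | empty => exact ⟨fun _ => 1, by fun_prop, by simp, by simp, by simp⟩
    | cons u s ih =>
      obtain ⟨g, hg, hg0, hgle, hgeq⟩ := ih
      obtain ⟨b, hb, hb0, hble, hbeq⟩ := exists_zeroFree_majorant_linear hR u
      refine ⟨fun z => b z * g z, by fun_prop, fun z hz => mul_ne_zero (hb0 z hz) (hg0 z hz),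
        fun z hz => ?_, fun z hz => ?_⟩
      · simp only [Multiset.map_cons, Multiset.prod_cons, norm_mul]
        exact mul_le_mul (hble z hz) (hgle z hz) (norm_nonneg _) (norm_nonneg _)
      · simp only [Multiset.map_cons, Multiset.prod_cons, norm_mul, hbeq z hz, hgeq z hz]
  obtain ⟨g, hg, hg0, hgle, hgeq⟩ := key P.roots
  have heval : ∀ z, P.eval z = P.leadingCoeff * (P.roots.map fun u => z - u).prod :=
    fun z => (IsAlgClosed.splits P).eval_eq_prod_roots z
  refine ⟨fun z => P.leadingCoeff * g z, by fun_prop, fun z hz =>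
    mul_ne_zero (Polynomial.leadingCoeff_ne_zero.2 hP) (hg0 z hz), fun z hz => ?_, fun z hz => ?_⟩
  · rw [heval, norm_mul, norm_mul]
    exact mul_le_mul_of_nonneg_left (hgle z hz) (norm_nonneg _)
  · rw [heval, norm_mul, norm_mul, hgeq z hz]

/-- Passing to the zero-free majorant can only increase the left side and leaves the right side
unchanged. -/
theorem circleAverage_norm_rpow_comp_le_polynomial (P : Polynomial ℂ) {φ : ℂ → ℂ} {p r R : ℝ}
    (hp : 0 < p) (hr : 0 ≤ r) (hφ : DifferentiableOn ℂ φ (closedBall 0 r))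
    (hmaps : MapsTo φ (closedBall 0 r) (ball 0 R)) :
    circleAverage (fun z => ‖P.eval (φ z)‖ ^ p) 0 r ≤
      (R + ‖φ 0‖) / (R - ‖φ 0‖) * circleAverage (fun z => ‖P.eval z‖ ^ p) 0 R := by
  have h0 : φ 0 ∈ ball (0 : ℂ) R := hmaps (by simpa using hr)
  have hR : 0 < R := pos_of_mem_ball h0
  rcases eq_or_ne P 0 with rfl | hP
  · simp [Real.zero_rpow hp.ne', circleAverage_const]
  obtain ⟨g, hg, hg0, hgle, hgeq⟩ := exists_zeroFree_majorant_polynomial hR hP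
  have hrs : sphere (0 : ℂ) |r| ⊆ closedBall 0 r := by
    rw [abs_of_nonneg hr]; exact sphere_subset_closedBall
  have hφc := hφ.continuousOn.mono hrs
  calc circleAverage (fun z => ‖P.eval (φ z)‖ ^ p) 0 r
      ≤ circleAverage (fun z => ‖g (φ z)‖ ^ p) 0 r := by
        refine circleAverage_mono ?_ ?_ ?_
        · exact (((P.continuous.comp_continuousOn hφc).norm).rpow_const
            fun x _ => Or.inr hp.le).circleIntegrable'
        · exact (((hg.continuous.comp_continuousOn hφc).norm).rpow_const
            fun x _ => Or.inr hp.le).circleIntegrable'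
        · intro z hz
          exact Real.rpow_le_rpow (norm_nonneg _)
            (hgle _ (ball_subset_closedBall (hmaps (hrs hz)))) hp.le
    _ ≤ (R + ‖φ 0‖) / (R - ‖φ 0‖) * circleAverage (fun z => ‖g z‖ ^ p) 0 R :=
        circleAverage_norm_rpow_comp_le_of_ne_zero hp hr hg.differentiableOn
          hg.continuous.continuousOn hg0 hφ hmaps
    _ = _ := by
        congr 1
        refine circleAverage_congr_sphere fun z hz => ?_
        rw [abs_of_pos hR] at hz
        simp only [hgeq z hz]

/-- Taylor polynomials approximate uniformly on smaller discs. -/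
theorem exists_polynomial_tendstoUniformlyOn {f : ℂ → ℂ} {R R' : ℝ} (hR : 0 ≤ R) (hRR : R < R')
    (hf : DifferentiableOn ℂ f (ball 0 R')) :
    ∃ P : ℕ → Polynomial ℂ,
      TendstoUniformlyOn (fun n z => (P n).eval z) f atTop (closedBall 0 R) := by
  obtain ⟨S, hS1, hS2⟩ := exists_between hRR
  lift S to ℝ≥0 using hR.trans hS1.le
  have hS0 : 0 < S := by exact_mod_cast hR.trans_lt hS1
  have hps := (hf.mono (closedBall_subset_ball hS2)).hasFPowerSeriesOnBall hS0
  obtain ⟨S', hS1', hS2'⟩ := exists_between hS1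
  lift S' to ℝ≥0 using hR.trans hS1'.le
  refine ⟨fun n => ∑ k ∈ Finset.range n, Polynomial.C ((cauchyPowerSeries f 0 S).coeff k) *
    Polynomial.X ^ k, ?_⟩
  have := (hps.tendstoUniformlyOn (r' := S') (by exact_mod_cast hS2')).mono
    (closedBall_subset_ball (x := (0 : ℂ)) hS1')
  simp only [zero_add] at this
  refine this.congr (Eventually.of_forall fun n z _ => ?_)
  simp only [FormalMultilinearSeries.partialSum, Polynomial.eval_finsetSum, Polynomial.eval_mul,
    Polynomial.eval_C, Polynomial.eval_pow, Polynomial.eval_X]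
  refine Finset.sum_congr rfl fun k _ => ?_
  rw [FormalMultilinearSeries.apply_eq_pow_smul_coeff, smul_eq_mul, mul_comm]

/-- **Littlewood-type subordination**: the `p`-means of `f ∘ φ` on a circle are controlled by those
of `f` on a circle enclosing the image. -/
theorem circleAverage_norm_rpow_comp_le {f φ : ℂ → ℂ} {p r R R' : ℝ} (hp : 0 < p) (hr : 0 ≤ r)
    (hRR : R < R') (hf : DifferentiableOn ℂ f (ball 0 R'))
    (hφ : DifferentiableOn ℂ φ (closedBall 0 r)) (hmaps : MapsTo φ (closedBall 0 r) (ball 0 R)) :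
    circleAverage (fun z => ‖f (φ z)‖ ^ p) 0 r ≤
      (R + ‖φ 0‖) / (R - ‖φ 0‖) * circleAverage (fun z => ‖f z‖ ^ p) 0 R := by
  have h0 : φ 0 ∈ ball (0 : ℂ) R := hmaps (by simpa using hr)
  have hR : 0 < R := pos_of_mem_ball h0
  obtain ⟨P, hP⟩ := exists_polynomial_tendstoUniformlyOn hR.le hRR hf
  have hfc : ContinuousOn f (closedBall 0 R) :=
    hf.continuousOn.mono (closedBall_subset_ball hRR)
  obtain ⟨B, hB⟩ := (isCompact_closedBall (0 : ℂ) R).exists_bound_of_continuousOn hfc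
  have hPB : ∀ᶠ n in atTop, ∀ z ∈ closedBall (0 : ℂ) R, ‖(P n).eval z‖ ≤ B + 1 := by
    filter_upwards [Metric.tendstoUniformlyOn_iff.1 hP 1 one_pos] with n hn z hz
    have h1 := hn z hz
    have h2 := hB z hz
    rw [dist_eq_norm] at h1
    have h3 := norm_sub_norm_le ((P n).eval z) (f z)
    rw [norm_sub_rev] at h3
    linarith
  have hB0 : 0 ≤ B := (norm_nonneg _).trans (hB 0 (by simpa using hR.le))
  have hlim : ∀ (ψ : ℂ → ℂ) (s : ℝ), ContinuousOn ψ (sphere 0 |s|) →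
      MapsTo ψ (sphere 0 |s|) (closedBall 0 R) →
      Tendsto (fun n => circleAverage (fun z => ‖(P n).eval (ψ z)‖ ^ p) 0 s) atTop
        (𝓝 (circleAverage (fun z => ‖f (ψ z)‖ ^ p) 0 s)) := by
    intro ψ s hψ hψm
    simp only [circleAverage_def]
    refine Tendsto.const_smul ?_ _
    refine intervalIntegral.tendsto_integral_filter_of_dominated_convergence
      (fun _ => (B + 1) ^ p) ?_ ?_ (by simp) ?_
    · refine Eventually.of_forall fun n => ?_
      have : CircleIntegrable (fun z => ‖(P n).eval (ψ z)‖ ^ p) 0 s :=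
        (((P n).continuous.comp_continuousOn hψ).norm.rpow_const
          fun x _ => Or.inr hp.le).circleIntegrable'
      exact this.def'.aestronglyMeasurable
    · filter_upwards [hPB] with n hn
      refine Eventually.of_forall fun θ _ => ?_
      rw [Real.norm_of_nonneg (by positivity)]
      exact Real.rpow_le_rpow (norm_nonneg _) (hn _ (hψm (circleMap_mem_sphere' 0 s θ))) hp.le
    · refine Eventually.of_forall fun θ _ => ?_
      exact ((hP.tendsto_at (hψm (circleMap_mem_sphere' 0 s θ))).norm).rpow_const (Or.inr hp.le)
  have hrs : sphere (0 : ℂ) |r| ⊆ closedBall 0 r := by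
    rw [abs_of_nonneg hr]; exact sphere_subset_closedBall
  refine le_of_tendsto_of_tendsto' (hlim φ r (hφ.continuousOn.mono hrs)
    ((hmaps.mono_right ball_subset_closedBall).mono_left hrs)) ((hlim id R continuousOn_id
      ?_).const_mul ((R + ‖φ 0‖) / (R - ‖φ 0‖))) fun n =>
        circleAverage_norm_rpow_comp_le_polynomial (P n) hp hr hφ hmaps
  intro z hz
  rw [abs_of_pos hR] at hz
  exact sphere_subset_closedBall hz

/-! ### Integral means, disc automorphisms and Schwarz–Pick -/

/-- The `p`-mean of `|f|` on the circle of radius `r`. -/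
noncomputable def powerMean (p : ℝ) (f : ℂ → ℂ) (r : ℝ) : ℝ :=
  circleAverage (fun z => ‖f z‖ ^ p) 0 r

theorem powerMean_nonneg (p : ℝ) (f : ℂ → ℂ) (r : ℝ) : 0 ≤ powerMean p f r :=
  circleAverage_nonneg_of_nonneg fun _ _ => by positivity

theorem continuousOn_powerMean {p : ℝ} (hp : 0 < p) {f : ℂ → ℂ}
    (hf : ContinuousOn f (ball 0 1)) : ContinuousOn (powerMean p f) (Ico 0 1) := by
  refine ContinuousOn.circleAverage ?_ fun x hx => hx.1
  refine (hf.norm.rpow_const fun x _ => Or.inr hp.le).mono fun z hz => ?_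
  simpa using hz.2

/-- Subordination with φ = id: there φ(0) = 0, so the constant is 1. -/
theorem monotoneOn_powerMean {p : ℝ} (hp : 0 < p) {f : ℂ → ℂ}
    (hf : DifferentiableOn ℂ f (ball 0 1)) : MonotoneOn (powerMean p f) (Ico 0 1) := by
  intro r hr R hR hrR
  rcases hrR.eq_or_lt with rfl | h
  · exact le_rfl
  have hR0 : 0 < R := hr.1.trans_lt h
  have := circleAverage_norm_rpow_comp_le (φ := id) hp hr.1 hR.2 hf differentiableOn_id
    (fun z hz => closedBall_subset_ball h hz)
  simpa [hR0.ne', powerMean] using this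

/-- Point evaluation at `0` is dominated by the `p`-mean. -/
theorem norm_rpow_le_powerMean {p : ℝ} (hp : 0 < p) {f : ℂ → ℂ}
    (hf : DifferentiableOn ℂ f (ball 0 1)) {r : ℝ} (hr : r ∈ Ico (0 : ℝ) 1) :
    ‖f 0‖ ^ p ≤ powerMean p f r := by
  have := monotoneOn_powerMean hp hf (show (0 : ℝ) ∈ Ico (0 : ℝ) 1 by simp) hr hr.1
  simpa [powerMean] using this

theorem norm_one_sub_sq_sub (b w : ℂ) :
    ‖1 - (starRingEnd ℂ) b * w‖ ^ 2 - ‖b - w‖ ^ 2 = (1 - ‖b‖ ^ 2) * (1 - ‖w‖ ^ 2) := by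
  simp only [← Complex.normSq_eq_norm_sq]
  simp only [Complex.normSq_apply, Complex.sub_re, Complex.sub_im, Complex.mul_re, Complex.mul_im,
    Complex.conj_re, Complex.conj_im, Complex.one_re, Complex.one_im]
  ring

theorem one_sub_conj_mul_ne_zero {b w : ℂ} (hb : ‖b‖ < 1) (hw : ‖w‖ < 1) :
    1 - (starRingEnd ℂ) b * w ≠ 0 := by
  intro h
  have h1 := norm_one_sub_sq_sub b w
  rw [h, norm_zero] at h1
  have h2 : 0 < (1 - ‖b‖ ^ 2) * (1 - ‖w‖ ^ 2) := by
    apply mul_pos <;> nlinarith [norm_nonneg b, norm_nonneg w]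
  nlinarith [sq_nonneg ‖b - w‖]

theorem isAnalyticSelfMap_discAut {b : ℂ} (hb : ‖b‖ < 1) : IsAnalyticSelfMap (discAut b) := by
  constructor
  · intro z hz
    have := one_sub_conj_mul_ne_zero hb (by simpa using hz : ‖z‖ < 1)
    unfold discAut
    fun_prop (disch := assumption)
  · intro z hz
    have hz' : ‖z‖ < 1 := by simpa using hz
    have h0 := one_sub_conj_mul_ne_zero hb hz'
    have h1 := norm_one_sub_sq_sub b z
    have h2 : 0 < (1 - ‖b‖ ^ 2) * (1 - ‖z‖ ^ 2) := by
      apply mul_pos <;> nlinarith [norm_nonneg b, norm_nonneg z]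
    rw [mem_ball_zero_iff, discAut, norm_div, div_lt_one (norm_pos_iff.2 h0)]
    exact lt_of_pow_lt_pow_left₀ 2 (norm_nonneg _) (by linarith)

/-- The **Schwarz–Pick** growth bound for analytic self-maps of the disc. -/
theorem IsAnalyticSelfMap.norm_le {φ : ℂ → ℂ} (hφ : IsAnalyticSelfMap φ) {z : ℂ}
    (hz : z ∈ ball (0 : ℂ) 1) :
    ‖φ z‖ ≤ (‖φ 0‖ + ‖z‖) / (1 + ‖φ 0‖ * ‖z‖) := by
  have hb : ‖φ 0‖ < 1 := by simpa using hφ.2 (mem_ball_self one_pos)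
  have hw : ‖φ z‖ < 1 := by simpa using hφ.2 hz
  have hz1 : ‖z‖ < 1 := by simpa using hz
  have haut := isAnalyticSelfMap_discAut hb
  have hs : ‖discAut (φ 0) (φ z)‖ ≤ ‖z‖ :=
    Complex.norm_le_norm_of_mapsTo_ball (f := fun z => discAut (φ 0) (φ z))
      (haut.1.comp hφ.1 hφ.2)
      (fun z hz => ball_subset_closedBall (haut.2 (hφ.2 hz))) (by simp [discAut]) hz1
  have h0 := one_sub_conj_mul_ne_zero hb hw
  rw [discAut, norm_div, div_le_iff₀ (norm_pos_iff.2 h0)] at hs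
  have h1 := norm_one_sub_sq_sub (φ 0) (φ z)
  have h2 : ‖φ 0 - φ z‖ ^ 2 ≤ ‖z‖ ^ 2 * ‖1 - (starRingEnd ℂ) (φ 0) * φ z‖ ^ 2 := by
    rw [← mul_pow]; exact pow_le_pow_left₀ (norm_nonneg _) hs 2
  have h3 : 1 - ‖φ 0‖ * ‖φ z‖ ≤ ‖1 - (starRingEnd ℂ) (φ 0) * φ z‖ := by
    have := norm_sub_norm_le (1 : ℂ) ((starRingEnd ℂ) (φ 0) * φ z)
    simpa using this
  set x := ‖φ 0‖
  set y := ‖φ z‖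
  set t := ‖z‖
  have hx0 : 0 ≤ x := norm_nonneg _
  have hy0 : 0 ≤ y := norm_nonneg _
  have ht0 : 0 ≤ t := norm_nonneg _
  have hxy : x * y < 1 := by nlinarith
  have h4 : (1 - x * y) ^ 2 ≤ ‖1 - (starRingEnd ℂ) (φ 0) * φ z‖ ^ 2 :=
    pow_le_pow_left₀ (by linarith) h3 2
  have ht2 : 0 ≤ 1 - t ^ 2 := by nlinarith
  -- By `h1` and `h2`, (1-t²)|1 - conj(φ(0)) φ(z)|² ≤ (1-x²)(1-y²) = (1-xy)² - (y-x)²; `h4` replaces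
  -- the modulus on the left by 1-xy.
  have h5 : (y - x) ^ 2 ≤ (t * (1 - x * y)) ^ 2 := by
    nlinarith [mul_le_mul_of_nonneg_left h4 ht2]
  have h6 : y - x ≤ t * (1 - x * y) :=
    le_of_sq_le_sq h5 (mul_nonneg ht0 (by linarith))
  rw [le_div_iff₀ (by positivity)]
  linarith

theorem pseudoSum_lt_pseudoSum {a r s : ℝ} (ha : 0 ≤ a) (ha1 : a < 1) (hr : 0 ≤ r) (hrs : r < s) :
    (a + r) / (1 + a * r) < (a + s) / (1 + a * s) := by
  have hs : 0 ≤ s := hr.trans hrs.le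
  rw [div_lt_div_iff₀ (by positivity) (by positivity)]
  nlinarith [mul_pos (show (0 : ℝ) < 1 - a ^ 2 by nlinarith) (sub_pos.2 hrs)]

theorem pseudoSum_mem_Ico {a r : ℝ} (ha : 0 ≤ a) (ha1 : a < 1) (hr : r ∈ Ico (0 : ℝ) 1) :
    (a + r) / (1 + a * r) ∈ Ico (0 : ℝ) 1 := by
  obtain ⟨h0, h1⟩ := hr
  refine ⟨by positivity, ?_⟩
  rw [div_lt_one (by positivity)]
  nlinarith

/-- The means of `f ∘ φ` are controlled by those of `f` at a comparable radius, with a constant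
depending only on `|φ(0)|`. -/
theorem powerMean_comp_le {p : ℝ} (hp : 0 < p) {f φ : ℂ → ℂ}
    (hf : DifferentiableOn ℂ f (ball 0 1)) (hφ : IsAnalyticSelfMap φ) {r : ℝ}
    (hr : r ∈ Ico (0 : ℝ) 1) :
    powerMean p (f ∘ φ) r ≤ 4 / (1 - ‖φ 0‖) *
      powerMean p f ((‖φ 0‖ + (1 + r) / 2) / (1 + ‖φ 0‖ * ((1 + r) / 2))) := by
  have hb : ‖φ 0‖ < 1 := by simpa using hφ.2 (mem_ball_self one_pos)
  have hb0 := norm_nonneg (φ 0)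
  set a := ‖φ 0‖
  have hs : (1 + r) / 2 ∈ Ico (0 : ℝ) 1 := ⟨by linarith [hr.1], by linarith [hr.2]⟩
  -- Enlarging r to s does two things: the closed disc of radius r lands in the open disc of radius
  -- R, and s ≥ 1/2 keeps R-a ≥ (1-a)/2 even when r is near 0.
  set s := (1 + r) / 2 with hsdef
  have hs2 : 1 / 2 ≤ s := by linarith [hr.1]
  have hR := pseudoSum_mem_Ico hb0 hb hs
  set R := (a + s) / (1 + a * s) with hRdef
  have hRs : R * (1 + a * s) = a + s := by
    rw [hRdef, div_mul_cancel₀]; positivity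
  have hsub : closedBall (0 : ℂ) r ⊆ ball 0 1 := closedBall_subset_ball hr.2
  have hmaps : MapsTo φ (closedBall 0 r) (ball 0 R) := by
    intro z hz
    have hzr : ‖z‖ ≤ r := by simpa using hz
    have h1 := hφ.norm_le (hsub hz)
    have h2 := pseudoSum_lt_pseudoSum hb0 hb (norm_nonneg z)
      (show ‖z‖ < s by linarith [hr.2])
    simpa using h1.trans_lt h2
  have h1 := circleAverage_norm_rpow_comp_le hp hr.1 hR.2 hf (hφ.1.mono hsub) hmaps
  refine h1.trans (mul_le_mul_of_nonneg_right ?_ (powerMean_nonneg p f R))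
  have hgap : (1 - a) / 2 ≤ R - a := by
    have h2 : (R - a) * (1 + a * s) = s * (1 - a ^ 2) := by linear_combination hRs
    have h3 : (1 - a) / 2 * (1 + a * s) ≤ (R - a) * (1 + a * s) := by
      rw [h2]
      have : (1 + a * s) / 2 ≤ s * (1 + a) := by nlinarith [hs.2, mul_nonneg hb0 hs.1]
      nlinarith
    exact le_of_mul_le_mul_right h3 (by have := hs.1; positivity)
  rw [div_le_div_iff₀ (by linarith) (by linarith)]
  nlinarith [hR.2]

/-! ### Polar coordinates and radial weights -/

theorem Complex.polarCoord_symm_eq_circleMap (x : ℝ × ℝ) :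
    Complex.polarCoord.symm x = circleMap 0 x.1 x.2 := by
  simp [Complex.polarCoord_symm_apply, circleMap, Complex.exp_mul_I]

/-- Integration in polar coordinates over the unit disc. -/
theorem setLIntegral_ball_eq_lintegral_prod (g : ℂ → ℝ≥0∞) :
    ∫⁻ z in ball (0 : ℂ) 1, g z =
      ∫⁻ x, ENNReal.ofReal x.1 * g (circleMap 0 x.1 x.2)
        ∂((volume.restrict (Ioo (0 : ℝ) 1)).prod (volume.restrict (Ioo (-π) π))) := by
  rw [← lintegral_indicator measurableSet_ball, ← Complex.lintegral_comp_polarCoord_symm,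
    Measure.prod_restrict, ← Measure.volume_eq_prod]
  have hsub : Ioo (0 : ℝ) 1 ×ˢ Ioo (-π) π ⊆ polarCoord.target := by
    intro x hx
    exact ⟨hx.1.1, hx.2⟩
  have hms : MeasurableSet (Ioo (0 : ℝ) 1 ×ˢ Ioo (-π) π) := measurableSet_Ioo.prod measurableSet_Ioo
  rw [← lintegral_indicator polarCoord.open_target.measurableSet, ← lintegral_indicator hms]
  refine lintegral_congr fun x => ?_
  simp only [Complex.polarCoord_symm_eq_circleMap]
  by_cases hx : x ∈ Ioo (0 : ℝ) 1 ×ˢ Ioo (-π) π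
  · rw [indicator_of_mem hx, indicator_of_mem (hsub hx), indicator_of_mem, smul_eq_mul]
    rw [mem_ball_zero_iff, norm_circleMap_zero, abs_of_pos hx.1.1]
    exact hx.1.2
  · rw [indicator_of_notMem hx]
    by_cases hx' : x ∈ polarCoord.target
    · rw [indicator_of_mem hx', indicator_of_notMem, smul_zero]
      rw [mem_ball_zero_iff, norm_circleMap_zero, abs_of_pos hx'.1]
      exact fun h => hx ⟨⟨hx'.1, h⟩, hx'.2⟩
    · rw [indicator_of_notMem hx']

theorem measurable_circleMap_prod : Measurable fun x : ℝ × ℝ => circleMap 0 x.1 x.2 := by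
  have : Continuous fun x : ℝ × ℝ => circleMap 0 x.1 x.2 := by fun_prop
  exact this.measurable

/-- The Jacobian r is positive on (0, 1), so null sets of the disc pull back to null sets of the (r,
θ) rectangle. -/
theorem ae_prod_of_ae_ball {P : ℂ → Prop} (h : ∀ᵐ z ∂(volume.restrict (ball (0 : ℂ) 1)), P z) :
    ∀ᵐ x ∂((volume.restrict (Ioo (0 : ℝ) 1)).prod (volume.restrict (Ioo (-π) π))),
      P (circleMap 0 x.1 x.2) := by
  set N := toMeasurable (volume.restrict (ball (0 : ℂ) 1)) {z | ¬ P z}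
  have hN : MeasurableSet N := measurableSet_toMeasurable _ _
  have hN0 : ∫⁻ z in ball (0 : ℂ) 1, N.indicator 1 z = 0 := by
    rw [lintegral_indicator_one hN, measure_toMeasurable]
    exact h
  rw [setLIntegral_ball_eq_lintegral_prod, lintegral_eq_zero_iff] at hN0
  · have hpos : ∀ᵐ x ∂((volume.restrict (Ioo (0 : ℝ) 1)).prod (volume.restrict (Ioo (-π) π))),
        x ∈ Ioo (0 : ℝ) 1 ×ˢ Ioo (-π) π := by
      rw [Measure.prod_restrict]
      exact ae_restrict_mem (measurableSet_Ioo.prod measurableSet_Ioo)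
    filter_upwards [hN0, hpos] with x hx hx'
    by_contra hP
    have : circleMap 0 x.1 x.2 ∈ N := subset_toMeasurable _ _ hP
    simp only [Pi.zero_apply, indicator_of_mem this, Pi.one_apply, mul_one,
      ENNReal.ofReal_eq_zero] at hx
    exact hx.not_gt hx'.1.1
  · exact (ENNReal.measurable_ofReal.comp measurable_fst).mul
      ((measurable_one.indicator hN).comp measurable_circleMap_prod)

theorem AEMeasurable.comp_circleMap {g : ℂ → ℝ≥0∞}
    (hg : AEMeasurable g (volume.restrict (ball (0 : ℂ) 1))) :
    AEMeasurable (fun x : ℝ × ℝ => g (circleMap 0 x.1 x.2))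
      ((volume.restrict (Ioo (0 : ℝ) 1)).prod (volume.restrict (Ioo (-π) π))) :=
  ⟨fun x => hg.mk g (circleMap 0 x.1 x.2), hg.measurable_mk.comp measurable_circleMap_prod,
    ae_prod_of_ae_ball hg.ae_eq_mk⟩

theorem setLIntegral_ball_eq_iterated {g : ℂ → ℝ≥0∞}
    (hg : AEMeasurable g (volume.restrict (ball (0 : ℂ) 1))) :
    ∫⁻ z in ball (0 : ℂ) 1, g z =
      ∫⁻ r in Ioo (0 : ℝ) 1, ENNReal.ofReal r * ∫⁻ θ in Ioo (-π) π, g (circleMap 0 r θ) := by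
  have hm : AEMeasurable (fun x : ℝ × ℝ => ENNReal.ofReal x.1 * g (circleMap 0 x.1 x.2))
      ((volume.restrict (Ioo (0 : ℝ) 1)).prod (volume.restrict (Ioo (-π) π))) :=
    (ENNReal.measurable_ofReal.comp measurable_fst).aemeasurable.mul hg.comp_circleMap
  rw [setLIntegral_ball_eq_lintegral_prod, lintegral_prod _ hm]
  refine lintegral_congr fun r => ?_
  exact lintegral_const_mul' _ _ ENNReal.ofReal_ne_top

theorem discArea_absolutelyContinuous : discArea ≪ volume.restrict (ball (0 : ℂ) 1) :=
  Measure.smul_absolutelyContinuous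

theorem absolutelyContinuous_discArea : volume.restrict (ball (0 : ℂ) 1) ≪ discArea := by
  refine Measure.absolutelyContinuous_smul ?_
  simp [Real.pi_pos]

theorem IsRadialWeight.aemeasurable {ω : ℂ → ℝ} (h : IsRadialWeight ω) :
    AEMeasurable (fun z => ENNReal.ofReal (ω z)) (volume.restrict (ball (0 : ℂ) 1)) :=
  (h.integrable.1.aemeasurable.mono_ac absolutelyContinuous_discArea).ennreal_ofReal

theorem IsRadialWeight.apply_circleMap {ω : ℂ → ℝ} (h : IsRadialWeight ω) {r : ℝ}
    (hr : r ∈ Ioo (0 : ℝ) 1) (θ : ℝ) : ω (circleMap 0 r θ) = ω (r : ℂ) := by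
  have h1 : ‖circleMap 0 r θ‖ = r := by rw [norm_circleMap_zero, abs_of_pos hr.1]
  rw [h.radial _ (by rw [mem_ball_zero_iff, h1]; exact hr.2), h1]

/-- A single ray is null in the plane, so restriction to it proves nothing. By Fubini, for almost
every angle ω agrees along that ray with a measurable function at almost every radius, and radiality
transfers this to the positive axis. -/
theorem IsRadialWeight.aemeasurable_radius {ω : ℂ → ℝ} (h : IsRadialWeight ω) :
    AEMeasurable (fun s : ℝ => ENNReal.ofReal (ω (s : ℂ))) (volume.restrict (Ioo (0 : ℝ) 1)) := by
  set g := h.aemeasurable.mk _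
  have hg : Measurable g := h.aemeasurable.measurable_mk
  have h1 := ae_prod_of_ae_ball h.aemeasurable.ae_eq_mk
  have h2 := Measure.ae_ae_of_ae_prod
    ((Measure.measurePreserving_swap (μ := volume.restrict (Ioo (-π) π))
      (ν := volume.restrict (Ioo (0 : ℝ) 1))).quasiMeasurePreserving.ae h1)
  have hne : (volume.restrict (Ioo (-π) π)) ≠ 0 := by
    rw [Ne, Measure.restrict_eq_zero, Real.volume_Ioo]
    simp [Real.pi_pos]
  have := ae_neBot.2 hne
  obtain ⟨θ, hθ⟩ := h2.exists
  refine ⟨fun s => g (circleMap 0 s θ), hg.comp ?_, ?_⟩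
  · exact measurable_circleMap_prod.comp (measurable_id.prodMk measurable_const)
  · filter_upwards [hθ, ae_restrict_mem measurableSet_Ioo] with s hs hs'
    simp only [Prod.swap, h.apply_circleMap hs'] at hs
    exact hs

/-- The measure `ω(s) ds` on `(0, 1)`. -/
noncomputable def radialMeasure (ω : ℂ → ℝ) : Measure ℝ :=
  (volume.restrict (Ioo (0 : ℝ) 1)).withDensity fun s => ENNReal.ofReal (ω (s : ℂ))

theorem radialMeasure_absolutelyContinuous (ω : ℂ → ℝ) :
    radialMeasure ω ≪ volume.restrict (Ioo (0 : ℝ) 1) :=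
  withDensity_absolutelyContinuous _ _

theorem ae_radialMeasure_mem (ω : ℂ → ℝ) : ∀ᵐ r ∂radialMeasure ω, r ∈ Ioo (0 : ℝ) 1 :=
  (radialMeasure_absolutelyContinuous ω).ae_le (ae_restrict_mem measurableSet_Ioo)

instance (ω : ℂ → ℝ) : NullSingletonClass (radialMeasure ω) :=
  ⟨fun x => radialMeasure_absolutelyContinuous ω (by simp)⟩

theorem radialMeasure_Ioi (ω : ℂ → ℝ) {r : ℝ} (hr : 0 ≤ r) :
    radialMeasure ω (Ioi r) = radialTail ω r := by
  rw [radialMeasure, withDensity_apply _ measurableSet_Ioi, Measure.restrict_restrict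
    measurableSet_Ioi, radialTail]
  have : Ioi r ∩ Ioo 0 1 = Ioo r 1 := by
    ext x
    simp only [mem_inter_iff, mem_Ioi, mem_Ioo]
    exact ⟨fun h => ⟨h.1, h.2.2⟩, fun h => ⟨h.1, hr.trans_lt h.1, h.2⟩⟩
  rw [this]

theorem lintegral_radialMeasure {ω : ℂ → ℝ} (h : IsRadialWeight ω) (g : ℝ → ℝ≥0∞) :
    ∫⁻ r, g r ∂radialMeasure ω =
      ∫⁻ r in Ioo (0 : ℝ) 1, ENNReal.ofReal (ω (r : ℂ)) * g r :=
  lintegral_withDensity_eq_lintegral_mul_non_measurable₀ _ h.aemeasurable_radius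
    (Eventually.of_forall fun _ => ENNReal.ofReal_lt_top) g

/-- Integration against `ω dA` in polar coordinates. -/
theorem lintegral_weightMeasure {ω : ℂ → ℝ} (h : IsRadialWeight ω) {g : ℂ → ℝ≥0∞}
    (hg : AEMeasurable g (volume.restrict (ball (0 : ℂ) 1))) :
    ∫⁻ z, g z ∂weightMeasure ω =
      ∫⁻ r, ENNReal.ofReal (2 * r) *
        (ENNReal.ofReal (2 * π)⁻¹ * ∫⁻ θ in Ioo (-π) π, g (circleMap 0 r θ)) ∂radialMeasure ω := by
  have hg' : AEMeasurable g discArea := hg.mono_ac discArea_absolutelyContinuous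
  rw [weightMeasure, lintegral_withDensity_eq_lintegral_mul₀
    (h.aemeasurable.mono_ac discArea_absolutelyContinuous) hg', discArea, lintegral_smul_measure,
    setLIntegral_ball_eq_iterated (h.aemeasurable.mul hg), lintegral_radialMeasure h, smul_eq_mul,
    ← lintegral_const_mul' _ _ ENNReal.ofReal_ne_top]
  refine setLIntegral_congr_fun measurableSet_Ioo fun r hr => ?_
  simp only [Pi.mul_apply, h.apply_circleMap hr]
  rw [lintegral_const_mul' _ _ ENNReal.ofReal_ne_top]
  have : ENNReal.ofReal π⁻¹ * ENNReal.ofReal r =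
      ENNReal.ofReal (2 * r) * ENNReal.ofReal (2 * π)⁻¹ := by
    rw [← ENNReal.ofReal_mul (by positivity), ← ENNReal.ofReal_mul (by linarith [hr.1])]
    congr 1
    field_simp
  rw [← mul_assoc, this]
  ring

theorem ofReal_powerMean {p : ℝ} (hp : 0 < p) {f : ℂ → ℂ} (hf : ContinuousOn f (ball 0 1))
    {r : ℝ} (hr : r ∈ Ico (0 : ℝ) 1) :
    ENNReal.ofReal (powerMean p f r) =
      ENNReal.ofReal (2 * π)⁻¹ * ∫⁻ θ in Ioo (-π) π, ‖f (circleMap 0 r θ)‖ₑ ^ p := by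
  have hc : Continuous fun θ => ‖f (circleMap 0 r θ)‖ ^ p := by
    refine Continuous.rpow_const ?_ fun _ => Or.inr hp.le
    refine (hf.comp_continuous (continuous_circleMap 0 r) fun θ => ?_).norm
    rw [mem_ball_zero_iff, norm_circleMap_zero, abs_of_nonneg hr.1]
    exact hr.2
  have hper : Function.Periodic (fun θ => ‖f (circleMap 0 r θ)‖ ^ p) (2 * π) := fun θ => by
    simp [periodic_circleMap 0 r θ]
  have h1 := hper.intervalIntegral_add_eq 0 (-π)
  rw [zero_add, show -π + 2 * π = π by ring] at h1
  rw [powerMean, circleAverage_def, smul_eq_mul, ENNReal.ofReal_mul (by positivity), h1,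
    intervalIntegral.integral_of_le (by linarith [pi_pos]), integral_Ioc_eq_integral_Ioo,
    ofReal_integral_eq_lintegral_ofReal
      ((hc.integrableOn_Icc (a := -π) (b := π)).mono_set Ioo_subset_Icc_self)
      (Eventually.of_forall fun θ => by positivity)]
  congr 1
  refine lintegral_congr fun θ => ?_
  rw [← ENNReal.ofReal_rpow_of_nonneg (norm_nonneg _) hp.le, ofReal_norm]

theorem bergmanNorm_rpow {p : ℝ} (hp : 0 < p) {ω : ℂ → ℝ} (h : IsRadialWeight ω) {f : ℂ → ℂ}
    (hf : ContinuousOn f (ball 0 1)) :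
    bergmanNorm p ω f ^ p =
      ∫⁻ r, ENNReal.ofReal (2 * r) * ENNReal.ofReal (powerMean p f r) ∂radialMeasure ω := by
  have hm : AEMeasurable (fun z => ‖f z‖ₑ ^ p) (volume.restrict (ball (0 : ℂ) 1)) :=
    ((hf.aemeasurable measurableSet_ball).enorm).pow_const p
  rw [bergmanNorm, eLpNorm_eq_lintegral_rpow_enorm_toReal (by simpa using hp) ENNReal.ofReal_ne_top,
    ENNReal.toReal_ofReal hp.le, ← ENNReal.rpow_mul, one_div, inv_mul_cancel₀ hp.ne',
    ENNReal.rpow_one, lintegral_weightMeasure h hm]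
  refine lintegral_congr_ae ?_
  filter_upwards [ae_radialMeasure_mem ω] with r hr
  rw [ofReal_powerMean hp hf ⟨hr.1.le, hr.2⟩]

/-! ### Tails of doubling weights and the general upper estimate -/

theorem radialTail_anti (ω : ℂ → ℝ) {r s : ℝ} (h : r ≤ s) : radialTail ω s ≤ radialTail ω r :=
  lintegral_mono_set (Ioo_subset_Ioo_left h)

theorem radialMeasure_Ici (ω : ℂ → ℝ) {r : ℝ} (hr : 0 ≤ r) :
    radialMeasure ω (Ici r) = radialTail ω r := by
  rw [← radialMeasure_Ioi ω hr, measure_congr Ioi_ae_eq_Ici]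

theorem weightMeasure_univ {ω : ℂ → ℝ} (h : IsRadialWeight ω) :
    weightMeasure ω univ = ∫⁻ r, ENNReal.ofReal (2 * r) ∂radialMeasure ω := by
  rw [← lintegral_one, lintegral_weightMeasure h aemeasurable_const]
  refine lintegral_congr fun r => ?_
  rw [setLIntegral_const, Real.volume_Ioo, one_mul, ← ENNReal.ofReal_mul (by positivity)]
  rw [show (2 * π)⁻¹ * (π - -π) = 1 by field_simp; ring]
  simp

theorem radialTail_half_le {ω : ℂ → ℝ} (h : IsRadialWeight ω) :
    radialTail ω (1 / 2) ≤ weightMeasure ω univ := by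
  rw [weightMeasure_univ h, ← radialMeasure_Ioi ω (by norm_num), ← setLIntegral_one]
  refine (setLIntegral_mono' measurableSet_Ioi fun r hr => ?_).trans (setLIntegral_le_lintegral _ _)
  rw [ENNReal.one_le_ofReal]
  have : 1 / 2 < r := hr
  linarith

theorem weightMeasure_univ_lt_top {ω : ℂ → ℝ} (h : IsRadialWeight ω) :
    weightMeasure ω univ < ∞ := by
  rw [weightMeasure, withDensity_apply _ MeasurableSet.univ, Measure.restrict_univ]
  exact h.integrable.lintegral_lt_top

section Doubling

variable {ω : ℂ → ℝ} {C : ℝ≥0}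

/-- The factor r in area measure means that integrability in the disc controls only the tail from
1/2; doubling at r = 0 supplies the rest. -/
theorem radialTail_zero_lt_top (h : IsRadialWeight ω)
    (hC : ∀ r : ℝ, 0 ≤ r → r < 1 → radialTail ω r ≤ C * radialTail ω ((1 + r) / 2)) :
    radialTail ω 0 < ∞ := by
  have h1 := hC 0 le_rfl one_pos
  rw [add_zero] at h1
  exact h1.trans_lt (ENNReal.mul_lt_top ENNReal.coe_lt_top
    ((radialTail_half_le h).trans_lt (weightMeasure_univ_lt_top h)))

/-- Each doubling step doubles the distance to 1 at the price of a factor C; the maximum with 0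
stops the process at the origin. -/
theorem radialTail_iterate
    (hC : ∀ r : ℝ, 0 ≤ r → r < 1 → radialTail ω r ≤ C * radialTail ω ((1 + r) / 2))
    {δ : ℝ} (hδ : 0 < δ) (hδ1 : δ ≤ 1) (k : ℕ) :
    radialTail ω (max 0 (1 - 2 ^ k * δ)) ≤ (C : ℝ≥0∞) ^ k * radialTail ω (1 - δ) := by
  induction k with
  | zero => simp [max_eq_right (sub_nonneg.2 hδ1)]
  | succ k ih =>
    have hpos : 0 < 2 ^ (k + 1) * δ := by positivity
    calc radialTail ω (max 0 (1 - 2 ^ (k + 1) * δ))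
        ≤ C * radialTail ω ((1 + max 0 (1 - 2 ^ (k + 1) * δ)) / 2) :=
          hC _ (le_max_left _ _) (max_lt one_pos (by linarith))
      _ ≤ C * radialTail ω (max 0 (1 - 2 ^ k * δ)) := by
          gcongr
          apply radialTail_anti
          rw [pow_succ] at hpos ⊢
          apply max_le
          · have := le_max_left 0 (1 - 2 ^ k * 2 * δ); linarith
          · have := le_max_right 0 (1 - 2 ^ k * 2 * δ); linarith
      _ ≤ C * ((C : ℝ≥0∞) ^ k * radialTail ω (1 - δ)) := by gcongr
      _ = _ := by rw [pow_succ]; ring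

theorem radialTail_pos
    (hC : ∀ r : ℝ, 0 ≤ r → r < 1 → radialTail ω r ≤ C * radialTail ω ((1 + r) / 2))
    (h0 : 0 < radialTail ω 0) {r : ℝ} (hr : r < 1) : 0 < radialTail ω r := by
  wlog hr0 : 0 ≤ r
  · exact h0.trans_le (radialTail_anti ω (le_of_not_ge hr0))
  obtain ⟨k, hk⟩ := pow_unbounded_of_one_lt (1 - r)⁻¹ (one_lt_two (α := ℝ))
  have h1 := radialTail_iterate hC (sub_pos.2 hr) (by linarith) k
  have h2 : 1 ≤ 2 ^ k * (1 - r) := by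
    have := mul_le_mul_of_nonneg_right hk.le (sub_pos.2 hr).le
    rwa [inv_mul_cancel₀ (sub_pos.2 hr).ne'] at this
  rw [max_eq_left (by linarith), sub_sub_cancel] at h1
  by_contra h3
  rw [not_lt, nonpos_iff_eq_zero] at h3
  rw [h3, mul_zero] at h1
  exact h0.not_ge h1

theorem radialTail_lt_top (h : IsRadialWeight ω)
    (hC : ∀ r : ℝ, 0 ≤ r → r < 1 → radialTail ω r ≤ C * radialTail ω ((1 + r) / 2))
    {r : ℝ} (hr : 0 ≤ r) : radialTail ω r < ∞ :=
  (radialTail_anti ω hr).trans_lt (radialTail_zero_lt_top h hC)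

/-- Comparison of integrals of monotone functions through the distribution function. -/
theorem lintegral_comp_le_of_measure_le {m : Measure ℝ} (hm : ∀ᵐ r ∂m, r ∈ Ioo (0 : ℝ) 1)
    {ρ A : ℝ → ℝ} (hρ : MapsTo ρ (Ioo 0 1) (Ioo 0 1)) (hρc : ContinuousOn ρ (Ioo 0 1))
    (hA : MonotoneOn A (Ioo 0 1)) (hAc : ContinuousOn A (Ioo 0 1)) (hA0 : ∀ r, 0 ≤ A r)
    {D : ℝ≥0∞} (hDt : D ≠ ∞)
    (hD : ∀ x ∈ Ico (0 : ℝ) 1,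
      m {r | r ∈ Ioo (0 : ℝ) 1 ∧ x ≤ ρ r} ≤ D * m (Ioi (max x (1 / 2)))) :
    ∫⁻ r, ENNReal.ofReal (A (ρ r)) ∂m ≤
      D * ∫⁻ r, ENNReal.ofReal (2 * r) * ENNReal.ofReal (A r) ∂m := by
  have hmr : m.restrict (Ioo 0 1) = m := Measure.restrict_eq_self_of_ae_mem hm
  have hAm : AEMeasurable A m := hmr ▸ hAc.aemeasurable measurableSet_Ioo
  have hAρ : AEMeasurable (fun r => A (ρ r)) m :=
    hmr ▸ (hAc.comp hρc hρ).aemeasurable measurableSet_Ioo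
  have hstep : ∫⁻ r in Ioi (1 / 2), ENNReal.ofReal (A r) ∂m ≤
      ∫⁻ r, ENNReal.ofReal (2 * r) * ENNReal.ofReal (A r) ∂m := by
    refine (setLIntegral_mono' measurableSet_Ioi fun r hr => ?_).trans
      (setLIntegral_le_lintegral _ _)
    refine le_mul_of_one_le_left' ?_
    rw [ENNReal.one_le_ofReal]
    have : 1 / 2 < r := hr
    linarith
  refine le_trans ?_ (mul_le_mul_right hstep D)
  rw [lintegral_eq_lintegral_meas_lt m (Eventually.of_forall fun r => hA0 _) hAρ,
    lintegral_eq_lintegral_meas_lt _ (Eventually.of_forall fun r => hA0 _) hAm.restrict,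
    ← lintegral_const_mul' _ _ hDt]
  refine lintegral_mono fun t => ?_
  -- By monotonicity `S` is an interval reaching up to 1, so its measure is a tail from its infimum.
  -- The cut at 1/2 in `hD` is there because the weight 2r is at least 1 only beyond 1/2.
  set S := {y | y ∈ Ioo (0 : ℝ) 1 ∧ t < A y}
  rcases S.eq_empty_or_nonempty with hS | ⟨y₀, hy₀⟩
  · have : m {r | t < A (ρ r)} = 0 := by
      refine measure_mono_null ?_ hm
      intro r hr hr'
      have : ρ r ∈ S := ⟨hρ hr', hr⟩
      rw [hS] at this
      exact this
    simp [this]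
  · have hbdd : BddBelow S := ⟨0, fun y hy => hy.1.1.le⟩
    set x := sInf S
    have hx : x ∈ Ico (0 : ℝ) 1 :=
      ⟨le_csInf ⟨y₀, hy₀⟩ fun y hy => hy.1.1.le, (csInf_le hbdd hy₀).trans_lt hy₀.1.2⟩
    calc m {r | t < A (ρ r)} ≤ m {r | r ∈ Ioo (0 : ℝ) 1 ∧ x ≤ ρ r} := by
          refine measure_mono_ae ?_
          filter_upwards [hm] with r hr hrt
          exact ⟨hr, csInf_le hbdd ⟨hρ hr, hrt⟩⟩
      _ ≤ D * m (Ioi (max x (1 / 2))) := hD x hx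
      _ ≤ D * (m.restrict (Ioi (1 / 2))) {a | t < A a} := by
          refine mul_le_mul_right ?_ D
          rw [Measure.restrict_apply' measurableSet_Ioi]
          refine measure_mono_ae ?_
          filter_upwards [hm] with r hr hrx
          obtain ⟨h1, h2⟩ := max_lt_iff.1 (show max x (1 / 2) < r from hrx)
          obtain ⟨y, hy, hyr⟩ := exists_lt_of_csInf_lt ⟨y₀, hy₀⟩ h1
          exact ⟨hy.2.trans_le (hA hy.1 hr hyr.le), h2⟩

/-- Norm estimate for composition operators in terms of the tails of the weight. -/
theorem bergmanNorm_comp_rpow_le (h : IsRadialWeight ω)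
    (hC : ∀ r : ℝ, 0 ≤ r → r < 1 → radialTail ω r ≤ C * radialTail ω ((1 + r) / 2))
    {p : ℝ} (hp : 0 < p) {φ : ℂ → ℂ} (hφ : IsAnalyticSelfMap φ) {D : ℝ≥0∞} (hDt : D ≠ ∞)
    (hD : ∀ x ∈ Ico (0 : ℝ) 1,
      radialTail ω (max 0 ((x - ‖φ 0‖) / (1 - ‖φ 0‖ * x))) ≤ D * radialTail ω x)
    {f : ℂ → ℂ} (hf : DifferentiableOn ℂ f (ball 0 1)) :
    bergmanNorm p ω (f ∘ φ) ^ p ≤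
      ENNReal.ofReal (8 / (1 - ‖φ 0‖)) * ((C : ℝ≥0∞) ^ 2 * D) * bergmanNorm p ω f ^ p := by
  have hb : ‖φ 0‖ < 1 := by simpa using hφ.2 (mem_ball_self one_pos)
  have hb0 := norm_nonneg (φ 0)
  rw [bergmanNorm_rpow hp h (hf.continuousOn.comp hφ.1.continuousOn hφ.2),
    bergmanNorm_rpow hp h hf.continuousOn]
  set a := ‖φ 0‖
  let ρ : ℝ → ℝ := fun r => (a + (1 + r) / 2) / (1 + a * ((1 + r) / 2))
  have hmaps : MapsTo ρ (Ioo 0 1) (Ioo 0 1) := by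
    intro r hr
    have h1 : (1 + r) / 2 ∈ Ico (0 : ℝ) 1 := ⟨by linarith [hr.1], by linarith [hr.2]⟩
    refine ⟨?_, (pseudoSum_mem_Ico hb0 hb h1).2⟩
    have := hr.1
    simp only [ρ]
    positivity
  have hcont : ContinuousOn ρ (Ioo 0 1) := by
    intro r hr
    have : 1 + a * ((1 + r) / 2) ≠ 0 := by have := hr.1; positivity
    simp only [ρ]
    fun_prop (disch := assumption)
  have hmono := (monotoneOn_powerMean hp hf).mono Ioo_subset_Ico_self
  have hpc := (continuousOn_powerMean hp hf.continuousOn).mono Ioo_subset_Ico_self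
  -- Doubling is used twice, hence C²: once because ρ(r) involves (1+r)/2 instead of r, once to move
  -- x to (1+x)/2, which lies beyond both x and 1/2.
  have hlc := lintegral_comp_le_of_measure_le (ae_radialMeasure_mem ω) hmaps hcont hmono hpc
    (powerMean_nonneg p f) (D := (C : ℝ≥0∞) ^ 2 * D)
    (ENNReal.mul_ne_top (by simp) hDt) (fun x hx => by
      have hax : 0 < 1 - a * x := by nlinarith [hx.1, hx.2]
      set s := (x - a) / (1 - a * x) with hs
      have hsx : s * (1 - a * x) = x - a := div_mul_cancel₀ _ hax.ne'
      have hs1 : s < 1 := by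
        rw [hs, div_lt_one hax]; nlinarith [hx.2]
      calc radialMeasure ω {r | r ∈ Ioo (0 : ℝ) 1 ∧ x ≤ ρ r}
          ≤ radialMeasure ω (Ici (max 0 (2 * s - 1))) := by
            refine measure_mono fun r hr => max_le hr.1.1.le ?_
            have h1 := hr.2
            have hr0 := hr.1.1
            simp only [ρ] at h1
            rw [le_div_iff₀ (by positivity)] at h1
            have h2 : s * (1 - a * x) ≤ (1 + r) / 2 * (1 - a * x) := by rw [hsx]; linarith
            have := le_of_mul_le_mul_right h2 hax
            linarith
        _ = radialTail ω (max 0 (2 * s - 1)) := radialMeasure_Ici ω (le_max_left _ _)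
        _ ≤ C * radialTail ω ((1 + max 0 (2 * s - 1)) / 2) :=
            hC _ (le_max_left _ _) (max_lt one_pos (by linarith))
        _ ≤ C * radialTail ω (max 0 s) := by
            gcongr
            apply radialTail_anti
            apply max_le
            · have := le_max_left 0 (2 * s - 1); linarith
            · have := le_max_right 0 (2 * s - 1); linarith
        _ ≤ C * (D * radialTail ω x) := by gcongr; exact hD x hx
        _ ≤ C * (D * (C * radialTail ω ((1 + x) / 2))) := by gcongr; exact hC x hx.1 hx.2
        _ = C ^ 2 * D * radialTail ω ((1 + x) / 2) := by ring
        _ ≤ C ^ 2 * D * radialMeasure ω (Ioi (max x (1 / 2))) := by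
            rw [radialMeasure_Ioi ω (le_max_of_le_left hx.1)]
            gcongr
            apply radialTail_anti
            apply max_le <;> linarith [hx.1, hx.2])
  calc ∫⁻ r, ENNReal.ofReal (2 * r) * ENNReal.ofReal (powerMean p (f ∘ φ) r) ∂radialMeasure ω
      ≤ ∫⁻ r, ENNReal.ofReal (8 / (1 - a)) * ENNReal.ofReal (powerMean p f (ρ r))
          ∂radialMeasure ω := by
        refine lintegral_mono_ae ?_
        filter_upwards [ae_radialMeasure_mem ω] with r hr
        have h1 := powerMean_comp_le hp hf hφ ⟨hr.1.le, hr.2⟩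
        have h2 : 0 ≤ 4 / (1 - a) := div_nonneg (by norm_num) (by linarith)
        have h3 : 0 ≤ powerMean p f (ρ r) := powerMean_nonneg _ _ _
        rw [← ENNReal.ofReal_mul (by linarith [hr.1]),
          ← ENNReal.ofReal_mul (div_nonneg (by norm_num) (by linarith))]
        apply ENNReal.ofReal_le_ofReal
        calc 2 * r * powerMean p (f ∘ φ) r ≤ 2 * (4 / (1 - a) * powerMean p f (ρ r)) := by
              apply mul_le_mul (by linarith [hr.2]) h1 (powerMean_nonneg _ _ _) (by norm_num)
          _ = _ := by ring
    _ = ENNReal.ofReal (8 / (1 - a)) * ∫⁻ r, ENNReal.ofReal (powerMean p f (ρ r))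
          ∂radialMeasure ω := lintegral_const_mul' _ _ ENNReal.ofReal_ne_top
    _ ≤ _ := by rw [mul_assoc]; gcongr

/-- 1 - (x-a)/(1-ax) = (1+a)(1-x)/(1-ax) is at most 2(1-x)/(1-a), so a number of doublings depending
only on a suffices. -/
theorem exists_tail_comparison
    (hC : ∀ r : ℝ, 0 ≤ r → r < 1 → radialTail ω r ≤ C * radialTail ω ((1 + r) / 2))
    {a : ℝ} (ha : 0 ≤ a) (ha1 : a < 1) :
    ∃ D : ℝ≥0, ∀ x ∈ Ico (0 : ℝ) 1,
      radialTail ω (max 0 ((x - a) / (1 - a * x))) ≤ D * radialTail ω x := by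
  obtain ⟨k, hk⟩ := pow_unbounded_of_one_lt (2 * (1 - a)⁻¹) (one_lt_two (α := ℝ))
  refine ⟨C ^ k, fun x hx => ?_⟩
  have h1 := radialTail_iterate hC (sub_pos.2 hx.2) (by linarith [hx.1]) k
  rw [sub_sub_cancel] at h1
  push_cast
  refine le_trans (radialTail_anti ω (max_le_max le_rfl ?_)) h1
  have hax : 0 < 1 - a * x := by nlinarith [hx.1, hx.2]
  rw [le_div_iff₀ hax]
  have h2 : 2 ≤ 2 ^ k * (1 - a) := by
    have := mul_le_mul_of_nonneg_right hk.le (sub_pos.2 ha1).le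
    rwa [mul_assoc, inv_mul_cancel₀ (sub_pos.2 ha1).ne', mul_one] at this
  have h3 : (1 + a) ≤ 2 ^ k * (1 - a * x) := by
    have : (2 : ℝ) ^ k * (1 - a) ≤ 2 ^ k * (1 - a * x) := by
      gcongr
      nlinarith [hx.2]
    linarith
  nlinarith [hx.2, mul_le_mul_of_nonneg_right h3 (sub_pos.2 hx.2).le]

end Doubling

/-! ### Norm inequalities and the operator norm -/

theorem bergmanNorm_rpow_eq_lintegral {p : ℝ} (hp : 0 < p) (ω : ℂ → ℝ) (f : ℂ → ℂ) :
    bergmanNorm p ω f ^ p = ∫⁻ z, ‖f z‖ₑ ^ p ∂weightMeasure ω := by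
  rw [bergmanNorm, eLpNorm_eq_lintegral_rpow_enorm_toReal (by simpa using hp) ENNReal.ofReal_ne_top,
    ENNReal.toReal_ofReal hp.le, ← ENNReal.rpow_mul, one_div, inv_mul_cancel₀ hp.ne',
    ENNReal.rpow_one]

theorem ae_weightMeasure_mem_ball (ω : ℂ → ℝ) : ∀ᵐ z ∂weightMeasure ω, z ∈ ball (0 : ℂ) 1 :=
  ((withDensity_absolutelyContinuous _ _).trans discArea_absolutelyContinuous).ae_le
    (ae_restrict_mem measurableSet_ball)

theorem IsAnalyticSelfMap.comp_differentiableOn {f φ : ℂ → ℂ} (hφ : IsAnalyticSelfMap φ)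
    (hf : DifferentiableOn ℂ f (ball 0 1)) : DifferentiableOn ℂ (f ∘ φ) (ball 0 1) :=
  hf.comp hφ.1 hφ.2

theorem compOpNorm_rpow_le {p : ℝ} (hp : 0 < p) {ω : ℂ → ℝ} {φ : ℂ → ℂ} {K : ℝ≥0∞}
    (hK : ∀ f, DifferentiableOn ℂ f (ball 0 1) →
      bergmanNorm p ω (f ∘ φ) ^ p ≤ K * bergmanNorm p ω f ^ p) :
    compOpNorm p ω φ ^ p ≤ K := by
  rw [← ENNReal.le_rpow_inv_iff hp, compOpNorm]
  refine iSup_le fun f => iSup_le fun hf => iSup_le fun hf1 => ?_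
  rw [ENNReal.le_rpow_inv_iff hp]
  refine (hK f hf.1).trans ?_
  exact mul_le_of_le_one_right' (ENNReal.rpow_le_one hf1 hp.le)

theorem compBounded_of_rpow_le {p : ℝ} (hp : 0 < p) {ω : ℂ → ℝ} {φ : ℂ → ℂ}
    (hφ : IsAnalyticSelfMap φ) {K : ℝ≥0∞} (hKt : K ≠ ∞)
    (hK : ∀ f, DifferentiableOn ℂ f (ball 0 1) →
      bergmanNorm p ω (f ∘ φ) ^ p ≤ K * bergmanNorm p ω f ^ p) :
    CompBounded p ω φ := by
  have hKp : K ^ p⁻¹ ≠ ∞ := ENNReal.rpow_ne_top_of_nonneg (by positivity) hKt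
  have h1 : ∀ f ∈ bergmanSpace p ω,
      bergmanNorm p ω (f ∘ φ) ≤ ((K ^ p⁻¹).toNNReal : ℝ≥0∞) * bergmanNorm p ω f := by
    intro f hf
    have := (ENNReal.le_rpow_inv_iff hp).2 (hK f hf.1)
    rwa [ENNReal.mul_rpow_of_nonneg _ _ (by positivity), ENNReal.rpow_rpow_inv hp.ne',
      ← ENNReal.coe_toNNReal hKp] at this
  exact ⟨fun f hf => ⟨hφ.comp_differentiableOn hf.1,
    (h1 f hf).trans_lt (ENNReal.mul_lt_top ENNReal.coe_lt_top hf.2)⟩, _, h1⟩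

/-- A test function of controlled norm bounds the operator norm from below. -/
theorem bergmanNorm_comp_rpow_le_mul_compOpNorm {p : ℝ} (hp : 0 < p) {ω : ℂ → ℝ} {f φ : ℂ → ℂ}
    (hf : DifferentiableOn ℂ f (ball 0 1)) {B : ℝ≥0∞} (hB0 : B ≠ 0) (hBt : B ≠ ∞)
    (hB : bergmanNorm p ω f ^ p ≤ B) :
    bergmanNorm p ω (f ∘ φ) ^ p ≤ B * compOpNorm p ω φ ^ p := by
  have hBp0 : B ^ p⁻¹ ≠ 0 := by
    simp [ENNReal.rpow_eq_zero_iff, hB0, hBt]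
  have hBpt : B ^ p⁻¹ ≠ ∞ := ENNReal.rpow_ne_top_of_nonneg (by positivity) hBt
  set c : ℝ := (B ^ p⁻¹).toReal⁻¹ with hc
  have hce : ‖(c : ℂ)‖ₑ = (B ^ p⁻¹)⁻¹ := by
    rw [← ofReal_norm, Complex.norm_real, Real.norm_of_nonneg (by positivity), hc,
      ENNReal.ofReal_inv_of_pos (ENNReal.toReal_pos hBp0 hBpt), ENNReal.ofReal_toReal hBpt]
  have hsm : ∀ g : ℂ → ℂ, bergmanNorm p ω ((c : ℂ) • g) = (B ^ p⁻¹)⁻¹ * bergmanNorm p ω g := by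
    intro g
    rw [bergmanNorm, eLpNorm_const_smul, hce]; rfl
  have hn : bergmanNorm p ω ((c : ℂ) • f) ≤ 1 := by
    rw [hsm, ← ENNReal.inv_mul_cancel hBp0 hBpt]
    gcongr
    exact (ENNReal.le_rpow_inv_iff hp).2 hB
  have hmem : (c : ℂ) • f ∈ bergmanSpace p ω := ⟨hf.const_smul _, hn.trans_lt ENNReal.one_lt_top⟩
  have h1 : bergmanNorm p ω (((c : ℂ) • f) ∘ φ) ≤ compOpNorm p ω φ :=
    le_iSup_of_le _ (le_iSup_of_le hmem (le_iSup_of_le hn le_rfl))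
  have h2 : ((c : ℂ) • f) ∘ φ = (c : ℂ) • (f ∘ φ) := rfl
  rw [h2, hsm, ENNReal.inv_mul_le_iff hBp0 hBpt] at h1
  calc bergmanNorm p ω (f ∘ φ) ^ p ≤ (B ^ p⁻¹ * compOpNorm p ω φ) ^ p :=
        ENNReal.rpow_le_rpow h1 hp.le
    _ = _ := by rw [ENNReal.mul_rpow_of_nonneg _ _ hp.le, ENNReal.rpow_inv_rpow hp.ne']

/-! ### Test functions and Carleson boxes -/

theorem powerMean_comp_rotation (p : ℝ) (f : ℂ → ℂ) (η r : ℝ) :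
    powerMean p (fun z => f (Complex.exp (η * Complex.I) * z)) r = powerMean p f r := by
  rw [powerMean, powerMean, circleAverage_def, circleAverage_eq_integral_add η]
  congr 1
  refine intervalIntegral.integral_congr fun θ _ => ?_
  simp only [circleMap, zero_add]
  congr 3
  push_cast
  rw [add_mul, Complex.exp_add]
  ring

/-- For |θ| ≤ π/2 the distance from 1 to the ray of angle θ is |sin θ|, and Jordan's inequality
applies; for larger angles the real part alone is at least 1. -/
theorem abs_div_pi_le_norm_one_sub {s θ : ℝ} (hs : 0 ≤ s) (hθ : |θ| ≤ π) :
    |θ| / π ≤ ‖1 - circleMap 0 s θ‖ := by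
  have hre : (1 - circleMap 0 s θ).re = 1 - s * Real.cos θ := by
    simp [circleMap, Complex.exp_ofReal_mul_I_re]
  have him : (1 - circleMap 0 s θ).im = - (s * Real.sin θ) := by
    simp [circleMap, Complex.exp_ofReal_mul_I_im]
  rcases le_or_gt |θ| (π / 2) with h | h
  · have h1 := Real.mul_abs_le_abs_sin h
    have h2 : |Real.sin θ| ≤ ‖1 - circleMap 0 s θ‖ := by
      refine abs_le_of_sq_le_sq ?_ (norm_nonneg _)
      rw [← Complex.normSq_eq_norm_sq, Complex.normSq_apply, hre, him]
      nlinarith [sq_nonneg (s - Real.cos θ), Real.sin_sq_add_cos_sq θ]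
    refine le_trans ?_ (h1.trans h2)
    rw [div_eq_inv_mul, div_eq_mul_inv]
    have : 0 ≤ π⁻¹ * |θ| := by positivity
    linarith
  · have hcos : Real.cos θ ≤ 0 := by
      rw [← Real.cos_abs]
      exact Real.cos_nonpos_of_pi_div_two_le_of_le h.le (by linarith [pi_pos])
    calc |θ| / π ≤ 1 := (div_le_one pi_pos).2 hθ
      _ ≤ (1 - circleMap 0 s θ).re := by rw [hre]; nlinarith
      _ ≤ _ := Complex.re_le_norm _

/-- The `ω dA` measure of a pseudo-Carleson box. -/
theorem weightMeasure_box_le {ω : ℂ → ℝ} (h : IsRadialWeight ω) {a η : ℝ} (ha : 0 ≤ a)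
    (ha1 : a < 1) (_hη : 0 ≤ η) :
    weightMeasure ω {z | ‖1 - a * z‖ ≤ η} ≤
      ENNReal.ofReal (2 * η) * radialTail ω (max 0 (1 - η)) := by
  set S : Set ℂ := {z | ‖1 - a * z‖ ≤ η}
  have hS : MeasurableSet S := measurableSet_le (by fun_prop) measurable_const
  rw [← lintegral_indicator_one hS, lintegral_weightMeasure h
    ((measurable_one.indicator hS).aemeasurable)]
  have hI : ENNReal.ofReal (2 * η) * radialTail ω (max 0 (1 - η)) =
      ∫⁻ r, (Ici (max 0 (1 - η))).indicator (fun _ => ENNReal.ofReal (2 * η)) r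
        ∂radialMeasure ω := by
    rw [lintegral_indicator measurableSet_Ici, setLIntegral_const,
      radialMeasure_Ici ω (le_max_left _ _)]
  rw [hI]
  refine lintegral_mono_ae ?_
  filter_upwards [ae_radialMeasure_mem ω] with r hr
  have hmul : ∀ θ : ℝ, (a : ℂ) * circleMap 0 r θ = circleMap 0 (a * r) θ := by
    intro θ; simp [circleMap, mul_assoc]
  by_cases hrη : r ∈ Ici (max 0 (1 - η))
  · rw [indicator_of_mem hrη]
    have harc : ∫⁻ θ in Ioo (-π) π, S.indicator 1 (circleMap 0 r θ) ≤
        ENNReal.ofReal (2 * π * η) := by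
      calc ∫⁻ θ in Ioo (-π) π, S.indicator 1 (circleMap 0 r θ)
          ≤ ∫⁻ θ in Ioo (-π) π, (Icc (-(π * η)) (π * η)).indicator 1 θ := by
            refine setLIntegral_mono' measurableSet_Ioo fun θ hθ => ?_
            by_cases hθS : circleMap 0 r θ ∈ S
            · have h1 := abs_div_pi_le_norm_one_sub (mul_nonneg ha hr.1.le)
                (abs_le.2 ⟨hθ.1.le, hθ.2.le⟩)
              have h2 : ‖1 - circleMap 0 (a * r) θ‖ ≤ η := by rw [← hmul]; exact hθS
              have h3 : |θ| ≤ π * η := by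
                rw [mul_comm]; exact (div_le_iff₀ pi_pos).1 (h1.trans h2)
              rw [indicator_of_mem hθS, indicator_of_mem (mem_Icc.2 (abs_le.1 h3))]
              simp
            · rw [indicator_of_notMem hθS]; exact zero_le
        _ ≤ ∫⁻ θ, (Icc (-(π * η)) (π * η)).indicator 1 θ := setLIntegral_le_lintegral _ _
        _ = ENNReal.ofReal (2 * π * η) := by
            rw [lintegral_indicator_one measurableSet_Icc, Real.volume_Icc]
            congr 1; ring
    calc ENNReal.ofReal (2 * r) * (ENNReal.ofReal (2 * π)⁻¹ *
          ∫⁻ θ in Ioo (-π) π, S.indicator 1 (circleMap 0 r θ))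
        ≤ ENNReal.ofReal 2 * (ENNReal.ofReal (2 * π)⁻¹ * ENNReal.ofReal (2 * π * η)) := by
          gcongr
          linarith [hr.2]
      _ = ENNReal.ofReal (2 * η) := by
          rw [← ENNReal.ofReal_mul (by positivity), ← ENNReal.ofReal_mul (by positivity)]
          congr 1
          field_simp
  · have hz : ∀ θ : ℝ, circleMap 0 r θ ∉ S := by
      intro θ hθ
      apply hrη
      refine max_le hr.1.le ?_
      -- A circle meets the box only if 1 - ar ≤ η, which forces r ≥ 1-η.
      have h1 : ‖(1 : ℂ)‖ - ‖(a : ℂ) * circleMap 0 r θ‖ ≤ η := (norm_sub_norm_le _ _).trans hθ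
      rw [hmul, norm_circleMap_zero, abs_of_nonneg (mul_nonneg ha hr.1.le), norm_one] at h1
      nlinarith [hr.1]
    simp [hz]

/-- The test function `((1 - a) / (1 - a z)) ^ n`. -/
noncomputable def testFunction (n : ℕ) (a : ℝ) (z : ℂ) : ℂ := ((1 - a) / (1 - a * z)) ^ n

theorem one_sub_le_norm_one_sub_mul {a : ℝ} (ha : 0 ≤ a) {z : ℂ} (hz : z ∈ ball (0 : ℂ) 1) :
    1 - a ≤ ‖1 - a * z‖ := by
  have hz' : ‖z‖ < 1 := by simpa using hz
  have := norm_sub_norm_le (1 : ℂ) (a * z)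
  rw [norm_one, norm_mul, Complex.norm_real, Real.norm_of_nonneg ha] at this
  nlinarith

theorem differentiableOn_testFunction (n : ℕ) {a : ℝ} (ha : 0 ≤ a) (ha1 : a < 1) :
    DifferentiableOn ℂ (testFunction n a) (ball 0 1) := by
  intro z hz
  have : 1 - (a : ℂ) * z ≠ 0 := by
    rw [← norm_pos_iff]
    linarith [one_sub_le_norm_one_sub_mul ha hz]
  unfold testFunction
  fun_prop (disch := assumption)

theorem norm_testFunction (n : ℕ) {a : ℝ} (ha1 : a < 1) (z : ℂ) :
    ‖testFunction n a z‖ = ((1 - a) / ‖1 - a * z‖) ^ n := by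
  rw [testFunction, norm_pow, norm_div, ← Complex.ofReal_one, ← Complex.ofReal_sub,
    Complex.norm_real, Real.norm_of_nonneg (by linarith)]

/-- Dyadic decomposition by the size of |1-az|/(1-a). The layer at scale 2^k lies in a box whose
mass is at most 4C (2C)^k (1-a) ω̂(a), by k+1 doublings. The hypothesis on n makes the p-th power of
the function at most (4C)^(-k) there, leaving a geometric series of ratio 1/2. -/
theorem bergmanNorm_testFunction_rpow_le {ω : ℂ → ℝ} (h : IsRadialWeight ω) {C : ℝ≥0}
    (hC : ∀ r : ℝ, 0 ≤ r → r < 1 → radialTail ω r ≤ C * radialTail ω ((1 + r) / 2))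
    (hC1 : 1 ≤ C) {p : ℝ} (hp : 0 < p) {n : ℕ} (hn : 4 * (C : ℝ) ≤ 2 ^ (n * p))
    {a : ℝ} (ha : 0 ≤ a) (ha1 : a < 1) :
    bergmanNorm p ω (testFunction n a) ^ p ≤
      8 * C * (ENNReal.ofReal (1 - a) * radialTail ω a) := by
  have hδ : 0 < 1 - a := by linarith
  rw [bergmanNorm_rpow_eq_lintegral hp]
  let S : ℕ → Set ℂ := fun k => {z | ‖1 - a * z‖ ≤ 2 ^ (k + 1) * (1 - a)}
  have hS : ∀ k, MeasurableSet (S k) := fun k => measurableSet_le (by fun_prop) measurable_const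
  let c : ℕ → ℝ≥0∞ := fun k => ((4 * (C : ℝ≥0∞)) ^ k)⁻¹
  have hpt : ∀ z ∈ ball (0 : ℂ) 1,
      ‖testFunction n a z‖ₑ ^ p ≤ ∑' k, (S k).indicator (fun _ => c k) z := by
    intro z hz
    have h1 := one_sub_le_norm_one_sub_mul ha hz
    set w := ‖1 - a * z‖
    have ht : 1 ≤ w / (1 - a) := (one_le_div hδ).2 h1
    obtain ⟨k, hk1, hk2⟩ := exists_nat_pow_near ht one_lt_two
    refine le_trans ?_ (ENNReal.le_tsum k)
    have hzS : z ∈ S k := ((div_lt_iff₀ hδ).1 hk2).le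
    rw [indicator_of_mem hzS, ← ofReal_norm, norm_testFunction n ha1,
      ENNReal.ofReal_rpow_of_nonneg (by positivity) hp.le]
    have hw : 0 < w := by linarith
    have h2 : (1 - a) / w ≤ (2 ^ k)⁻¹ := by
      rw [← inv_div]; exact inv_anti₀ (by positivity) hk1
    have h3 : (((1 - a) / w) ^ n) ^ p ≤ ((4 * (C : ℝ)) ^ k)⁻¹ := by
      calc (((1 - a) / w) ^ n) ^ p ≤ (((2 ^ k : ℝ)⁻¹) ^ n) ^ p := by gcongr
        _ = (((2 : ℝ) ^ (n * p)) ^ k)⁻¹ := by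
            rw [inv_pow, Real.inv_rpow (by positivity), ← pow_mul, ← Real.rpow_natCast,
              ← Real.rpow_mul (by norm_num), ← Real.rpow_natCast, ← Real.rpow_mul (by norm_num)]
            congr 2
            push_cast; ring
        _ ≤ _ := by
            have : (0 : ℝ) < C := by exact_mod_cast one_pos.trans_le hC1
            gcongr
    refine (ENNReal.ofReal_le_ofReal h3).trans_eq ?_
    have hCp : (0 : ℝ) < C := by exact_mod_cast one_pos.trans_le hC1
    rw [ENNReal.ofReal_inv_of_pos (by positivity), ENNReal.ofReal_pow (by positivity),
      ENNReal.ofReal_mul (by norm_num), ENNReal.ofReal_coe_nnreal]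
    simp [c]
  have hC0 : (C : ℝ≥0∞) ≠ 0 := by
    have := one_pos.trans_le hC1
    exact_mod_cast this.ne'
  calc ∫⁻ z, ‖testFunction n a z‖ₑ ^ p ∂weightMeasure ω
      ≤ ∫⁻ z, ∑' k, (S k).indicator (fun _ => c k) z ∂weightMeasure ω := by
        refine lintegral_mono_ae ?_
        filter_upwards [ae_weightMeasure_mem_ball ω] with z hz using hpt z hz
    _ = ∑' k, c k * weightMeasure ω (S k) := by
        rw [lintegral_tsum fun k => (measurable_const.indicator (hS k)).aemeasurable]
        simp [hS]
    _ ≤ ∑' k : ℕ, 4 * C * (ENNReal.ofReal (1 - a) * radialTail ω a) * (2⁻¹ : ℝ≥0∞) ^ k := by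
        refine ENNReal.tsum_le_tsum fun k => ?_
        have h1 := weightMeasure_box_le h ha ha1
          (show (0 : ℝ) ≤ 2 ^ (k + 1) * (1 - a) by positivity)
        have h2 := radialTail_iterate hC hδ (by linarith) (k + 1)
        rw [sub_sub_cancel] at h2
        calc c k * weightMeasure ω (S k)
            ≤ c k * (ENNReal.ofReal (2 * (2 ^ (k + 1) * (1 - a))) *
                ((C : ℝ≥0∞) ^ (k + 1) * radialTail ω a)) := by
              gcongr
              exact h1.trans (by gcongr)
          _ = 4 * C * (ENNReal.ofReal (1 - a) * radialTail ω a) *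
                (((4 * (C : ℝ≥0∞)) ^ k)⁻¹ * (2 ^ k * C ^ k)) := by
              rw [ENNReal.ofReal_mul (by norm_num), ENNReal.ofReal_mul (by positivity),
                ENNReal.ofReal_pow (by norm_num)]
              simp only [c, ENNReal.ofReal_ofNat, pow_succ]
              ring
          _ = _ := by
              congr 1
              rw [← mul_pow, ENNReal.inv_pow, ← mul_pow]
              congr 1
              rw [show (4 : ℝ≥0∞) * C = 2 * (2 * C) by ring,
                ENNReal.mul_inv (by simp) (by simp), mul_assoc,
                ENNReal.inv_mul_cancel (mul_ne_zero two_ne_zero hC0)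
                  (ENNReal.mul_ne_top (by simp) (by simp)), mul_one]
    _ = _ := by
        rw [ENNReal.tsum_mul_left, ENNReal.tsum_geometric, ENNReal.one_sub_inv_two, inv_inv]
        ring

theorem exists_rotation_eq_norm (b : ℂ) : ∃ η : ℝ, Complex.exp (η * Complex.I) * b = (‖b‖ : ℂ) := by
  refine ⟨-b.arg, ?_⟩
  have h := Complex.norm_mul_exp_arg_mul_I b
  calc Complex.exp ((-b.arg : ℝ) * Complex.I) * b
      = Complex.exp ((-b.arg : ℝ) * Complex.I) * (‖b‖ * Complex.exp (b.arg * Complex.I)) := by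
        rw [h]
    _ = ‖b‖ * (Complex.exp ((-b.arg : ℝ) * Complex.I) * Complex.exp (b.arg * Complex.I)) := by ring
    _ = _ := by rw [← Complex.exp_add]; simp

theorem norm_exp_mul_I_mul (η : ℝ) (z : ℂ) : ‖Complex.exp (η * Complex.I) * z‖ = ‖z‖ := by
  rw [norm_mul, Complex.norm_exp_ofReal_mul_I, one_mul]

theorem DifferentiableOn.comp_rotation {f : ℂ → ℂ} (hf : DifferentiableOn ℂ f (ball 0 1)) (η : ℝ) :
    DifferentiableOn ℂ (fun z => f (Complex.exp (η * Complex.I) * z)) (ball 0 1) :=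
  hf.comp (by fun_prop) fun z hz => by
    rw [mem_ball_zero_iff, norm_exp_mul_I_mul]; simpa using hz

theorem bergmanNorm_comp_rotation_rpow {p : ℝ} (hp : 0 < p) {ω : ℂ → ℝ} (h : IsRadialWeight ω)
    {f : ℂ → ℂ} (hf : DifferentiableOn ℂ f (ball 0 1)) (η : ℝ) :
    bergmanNorm p ω (fun z => f (Complex.exp (η * Complex.I) * z)) ^ p = bergmanNorm p ω f ^ p := by
  rw [bergmanNorm_rpow hp h (hf.comp_rotation η).continuousOn, bergmanNorm_rpow hp h hf.continuousOn]
  simp only [powerMean_comp_rotation]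

/-- The means of |f|^p increase from |f(0)|^p, and the total mass of ω dA is at least the tail from
1/2. -/
theorem norm_rpow_mul_tail_le_bergmanNorm {p : ℝ} (hp : 0 < p) {ω : ℂ → ℝ} (h : IsRadialWeight ω)
    {f : ℂ → ℂ} (hf : DifferentiableOn ℂ f (ball 0 1)) :
    ENNReal.ofReal (‖f 0‖ ^ p) * radialTail ω (1 / 2) ≤ bergmanNorm p ω f ^ p := by
  rw [bergmanNorm_rpow hp h hf.continuousOn]
  calc ENNReal.ofReal (‖f 0‖ ^ p) * radialTail ω (1 / 2)
      ≤ ENNReal.ofReal (‖f 0‖ ^ p) * ∫⁻ r, ENNReal.ofReal (2 * r) ∂radialMeasure ω := by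
        rw [← weightMeasure_univ h]
        gcongr
        exact radialTail_half_le h
    _ = ∫⁻ r, ENNReal.ofReal (‖f 0‖ ^ p) * ENNReal.ofReal (2 * r) ∂radialMeasure ω :=
        (lintegral_const_mul' _ _ ENNReal.ofReal_ne_top).symm
    _ ≤ _ := by
        refine lintegral_mono_ae ?_
        filter_upwards [ae_radialMeasure_mem ω] with r hr
        rw [mul_comm]
        gcongr
        exact norm_rpow_le_powerMean hp hf ⟨hr.1.le, hr.2⟩

/-! ### Lower estimates and necessity of the tail condition -/

section Doubling

variable {ω : ℂ → ℝ} {C : ℝ≥0}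

theorem le_compOpNorm_rpow (h : IsRadialWeight ω)
    (hC : ∀ r : ℝ, 0 ≤ r → r < 1 → radialTail ω r ≤ C * radialTail ω ((1 + r) / 2))
    (hC1 : 1 ≤ C) (h0 : 0 < radialTail ω 0) {p : ℝ} (hp : 0 < p) {n : ℕ}
    (hn : 4 * (C : ℝ) ≤ 2 ^ (n * p)) {φ : ℂ → ℂ} (hφ : IsAnalyticSelfMap φ) :
    ENNReal.ofReal (((1 / 2 : ℝ) ^ n) ^ p) * radialTail ω (1 / 2) ≤
      8 * C * (ENNReal.ofReal (1 - ‖φ 0‖) * radialTail ω ‖φ 0‖) * compOpNorm p ω φ ^ p := by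
  have hb : ‖φ 0‖ < 1 := by simpa using hφ.2 (mem_ball_self one_pos)
  have hb0 := norm_nonneg (φ 0)
  obtain ⟨η, hη⟩ := exists_rotation_eq_norm (φ 0)
  have hd := differentiableOn_testFunction n hb0 hb
  have hdr := hd.comp_rotation η
  have hT := (radialTail_pos hC h0 hb).ne'
  have hTt := (radialTail_lt_top h hC hb0).ne
  have hC0 : (C : ℝ≥0∞) ≠ 0 := by
    have := one_pos.trans_le hC1
    exact_mod_cast this.ne'
  have hδ : ENNReal.ofReal (1 - ‖φ 0‖) ≠ 0 := by simpa using hb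
  have hB := bergmanNorm_testFunction_rpow_le h hC hC1 hp hn hb0 hb
  rw [← bergmanNorm_comp_rotation_rpow hp h hd η] at hB
  have h1 := bergmanNorm_comp_rpow_le_mul_compOpNorm (φ := φ) hp hdr
    (mul_ne_zero (mul_ne_zero (by norm_num) hC0) (mul_ne_zero hδ hT))
    (ENNReal.mul_ne_top (ENNReal.mul_ne_top (by simp) (by simp))
      (ENNReal.mul_ne_top ENNReal.ofReal_ne_top hTt)) hB
  refine le_trans ?_ h1
  refine le_trans ?_ (norm_rpow_mul_tail_le_bergmanNorm hp h (hφ.comp_differentiableOn hdr))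
  gcongr
  -- The rotation carries φ(0) to a = |φ(0)|, where the base of the power is (1-a)/(1-a²) = 1/(1+a)
  -- ≥ 1/2.
  simp only [Function.comp_apply, hη]
  rw [norm_testFunction n hb, ← Complex.ofReal_mul, ← Complex.ofReal_one, ← Complex.ofReal_sub,
    Complex.norm_real, Real.norm_of_nonneg (by nlinarith)]
  refine pow_le_pow_left₀ (by norm_num) ?_ n
  rw [div_le_div_iff₀ (by norm_num) (by nlinarith)]
  nlinarith

/-- φ_r sends -1 to 1, where the test function is concentrated, so f_t ∘ φ_r is large near -1; the
sign in the argument moves this box to 1. The constant 6 is 3 · 2, from |1-sz| ≤ 3(1-s) on the box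
and (1-tr)(1-s) = (1-t)(1+r) ≤ 2(1-t), while |1+rz| ≥ 1. -/
theorem norm_testFunction_comp_discAut_ge (n : ℕ) {r t : ℝ} (hr : 0 ≤ r) (hrt : r ≤ t)
    (ht : t < 1) {ρ θ : ℝ} (hρ : ρ ∈ Ioo (0 : ℝ) 1) (hρs : (t - r) / (1 - t * r) ≤ ρ)
    (hθ : |θ| ≤ 1 - (t - r) / (1 - t * r)) :
    (1 / 6 : ℝ) ^ n ≤ ‖testFunction n t (discAut r (-circleMap 0 ρ θ))‖ := by
  have htr : 0 < 1 - t * r := by nlinarith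
  set s := (t - r) / (1 - t * r) with hs
  have hs0 : 0 ≤ s := div_nonneg (by linarith) htr.le
  have hsm : s * (1 - t * r) = t - r := div_mul_cancel₀ _ htr.ne'
  have hs1 : s < 1 := by rw [hs, div_lt_one htr]; nlinarith
  set z := circleMap 0 ρ θ with hz
  have hθ1 : |θ| ≤ 1 := by linarith
  have hcos : 0 ≤ Real.cos θ := Real.cos_nonneg_of_mem_Icc
    ⟨by linarith [(abs_le.1 hθ1).1, pi_gt_three], by linarith [(abs_le.1 hθ1).2, pi_gt_three]⟩
  have hre : z.re = ρ * Real.cos θ := by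
    simp [hz, circleMap, Complex.exp_ofReal_mul_I_re]
  have hA : 1 ≤ ‖1 + (r : ℂ) * z‖ := by
    have h1 : (1 + (r : ℂ) * z).re = 1 + r * (ρ * Real.cos θ) := by simp [hre]
    have h2 := Complex.re_le_norm (1 + (r : ℂ) * z)
    have h3 : 0 ≤ r * (ρ * Real.cos θ) := mul_nonneg hr (mul_nonneg hρ.1.le hcos)
    linarith
  have hA0 : 1 + (r : ℂ) * z ≠ 0 := by
    rw [← norm_pos_iff]; linarith
  have hB : ‖1 - (s : ℂ) * z‖ ≤ 3 * (1 - s) := by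
    have h1 : 1 - (s : ℂ) * z = ((1 - s * ρ : ℝ) : ℂ) +
        ((s * ρ : ℝ) : ℂ) * (1 - Complex.exp (Complex.I * θ)) := by
      simp only [hz, circleMap]; push_cast; ring_nf
    have h2 : ‖1 - Complex.exp (Complex.I * θ)‖ ≤ |θ| := by
      rw [norm_sub_rev]; exact Real.norm_exp_I_mul_ofReal_sub_one_le
    have hsρ : 0 ≤ s * ρ := mul_nonneg hs0 hρ.1.le
    have hsρ1 : s * ρ ≤ 1 := by nlinarith [hρ.2]
    rw [h1]
    refine (norm_add_le _ _).trans ?_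
    rw [norm_mul, Complex.norm_real, Complex.norm_real, Real.norm_of_nonneg hsρ,
      Real.norm_of_nonneg (by linarith)]
    have h3 : s * ρ * ‖1 - Complex.exp (Complex.I * θ)‖ ≤ 1 * (1 - s) := by
      apply mul_le_mul hsρ1 (h2.trans hθ) (norm_nonneg _) zero_le_one
    nlinarith
  have hkey : 1 - (t : ℂ) * discAut r (-z) = ((1 - t * r : ℝ) : ℂ) * (1 - s * z) / (1 + r * z) := by
    have hsm' : (s : ℂ) * (1 - t * r) = t - r := by exact_mod_cast hsm
    rw [discAut, Complex.conj_ofReal, mul_neg, sub_neg_eq_add, sub_neg_eq_add, eq_div_iff hA0,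
      sub_mul, mul_assoc, div_mul_cancel₀ _ hA0]
    push_cast
    linear_combination (z : ℂ) * hsm'
  have hnum : (1 - t * r) * (1 - s) ≤ 2 * (1 - t) := by
    have : (1 - t * r) * (1 - s) = (1 - t) * (1 + r) := by linear_combination -hsm
    rw [this]
    nlinarith
  rw [norm_testFunction n ht, hkey, norm_div, norm_mul, Complex.norm_real,
    Real.norm_of_nonneg htr.le]
  have hden : (1 - t * r) * ‖1 - (s : ℂ) * z‖ / ‖1 + (r : ℂ) * z‖ ≤ 6 * (1 - t) := by
    rw [div_le_iff₀ (by linarith)]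
    nlinarith [mul_le_mul_of_nonneg_left hB htr.le]
  have hB0 : 0 < ‖1 - (s : ℂ) * z‖ := by
    rw [norm_pos_iff]
    intro h
    have h1 : ‖(s : ℂ) * z‖ = 1 := by rw [← sub_eq_zero.1 h, norm_one]
    rw [norm_mul, hz, norm_circleMap_zero, abs_of_pos hρ.1, Complex.norm_real,
      Real.norm_of_nonneg hs0] at h1
    nlinarith [hρ.1, hρ.2]
  refine pow_le_pow_left₀ (by norm_num) ?_ n
  rw [le_div_iff₀ (by positivity)]
  linarith

/-- Integrates the pointwise bound over the box of angular width 2(1-s). Only radii beyond (1+s)/2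
are kept, so that 2ρ ≥ 1 even for s = 0; doubling then recovers the tail from s. -/
theorem le_bergmanNorm_testFunction_comp_discAut (h : IsRadialWeight ω)
    (hC : ∀ r : ℝ, 0 ≤ r → r < 1 → radialTail ω r ≤ C * radialTail ω ((1 + r) / 2))
    {p : ℝ} (hp : 0 < p) (n : ℕ) {r t : ℝ} (hr : 0 ≤ r) (hrt : r ≤ t) (ht : t < 1) :
    ENNReal.ofReal (((1 / 6 : ℝ) ^ n) ^ p * (π⁻¹ * (1 - (t - r) / (1 - t * r)))) *
        radialTail ω ((t - r) / (1 - t * r)) ≤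
      C * bergmanNorm p ω (testFunction n t ∘ discAut r) ^ p := by
  have ht0 := hr.trans hrt
  have htr : 0 < 1 - t * r := by nlinarith
  set s := (t - r) / (1 - t * r) with hs
  have hs0 : 0 ≤ s := div_nonneg (by linarith) htr.le
  have hs1 : s < 1 := by rw [hs, div_lt_one htr]; nlinarith
  have haut : IsAnalyticSelfMap (discAut (r : ℂ)) := isAnalyticSelfMap_discAut (by
    rw [Complex.norm_real, Real.norm_of_nonneg hr]; linarith)
  have hf := haut.comp_differentiableOn (differentiableOn_testFunction n ht0 ht)
  have hfr := hf.comp_rotation π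
  rw [← bergmanNorm_comp_rotation_rpow hp h hf π, bergmanNorm_rpow hp h hfr.continuousOn]
  set L := ((1 / 6 : ℝ) ^ n) ^ p * (π⁻¹ * (1 - s))
  calc ENNReal.ofReal L * radialTail ω s
      ≤ ENNReal.ofReal L * (C * radialTail ω ((1 + s) / 2)) := by gcongr; exact hC s hs0 hs1
    _ = C * (ENNReal.ofReal L * radialTail ω ((1 + s) / 2)) := by ring
    _ = C * ∫⁻ _ in Ioi ((1 + s) / 2), ENNReal.ofReal L ∂radialMeasure ω := by
        rw [setLIntegral_const, radialMeasure_Ioi ω (by linarith)]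
    _ ≤ C * ∫⁻ ρ in Ioi ((1 + s) / 2), ENNReal.ofReal (2 * ρ) * ENNReal.ofReal (powerMean p
          (fun z => (testFunction n t ∘ discAut r) (Complex.exp (π * Complex.I) * z)) ρ)
          ∂radialMeasure ω := by
        refine mul_le_mul_right ?_ _
        refine lintegral_mono_ae ?_
        filter_upwards [ae_restrict_mem measurableSet_Ioi,
          ae_restrict_of_ae (ae_radialMeasure_mem ω)] with ρ hρs hρ
        have hρs' : (1 + s) / 2 < ρ := hρs
        have h2ρ : 1 ≤ ENNReal.ofReal (2 * ρ) := by
          rw [ENNReal.one_le_ofReal]; linarith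
        refine le_trans ?_ (le_mul_of_one_le_left' h2ρ)
        rw [ofReal_powerMean hp hfr.continuousOn ⟨hρ.1.le, hρ.2⟩]
        calc ENNReal.ofReal L = ENNReal.ofReal (2 * π)⁻¹ *
              (ENNReal.ofReal (((1 / 6 : ℝ) ^ n) ^ p) * ENNReal.ofReal (2 * (1 - s))) := by
              rw [← ENNReal.ofReal_mul (by positivity), ← ENNReal.ofReal_mul (by positivity)]
              congr 1
              simp only [L]
              field_simp
          _ = ENNReal.ofReal (2 * π)⁻¹ * ∫⁻ _ in Ioo (-(1 - s)) (1 - s),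
                ENNReal.ofReal (((1 / 6 : ℝ) ^ n) ^ p) := by
              rw [setLIntegral_const, Real.volume_Ioo, sub_neg_eq_add, ← two_mul]
          _ ≤ ENNReal.ofReal (2 * π)⁻¹ * ∫⁻ θ in Ioo (-(1 - s)) (1 - s),
                ‖(testFunction n t ∘ discAut r)
                  (Complex.exp (π * Complex.I) * circleMap 0 ρ θ)‖ₑ ^ p := by
              refine mul_le_mul_right ?_ _
              refine setLIntegral_mono' measurableSet_Ioo fun θ hθ => ?_
              rw [Complex.exp_pi_mul_I, neg_one_mul, ← ofReal_norm,
                ENNReal.ofReal_rpow_of_nonneg (norm_nonneg _) hp.le]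
              have := norm_testFunction_comp_discAut_ge n hr hrt ht hρ (by linarith)
                (abs_le.2 ⟨hθ.1.le, hθ.2.le⟩)
              apply ENNReal.ofReal_le_ofReal
              exact Real.rpow_le_rpow (by positivity) this hp.le
          _ ≤ _ := by
              refine mul_le_mul_right ?_ _
              refine lintegral_mono_set (Ioo_subset_Ioo ?_ ?_) <;> linarith [pi_gt_three]
    _ ≤ _ := mul_le_mul_right (setLIntegral_le_lintegral _ _) _

/-- If the operator norms obey the upper bound, the weight satisfies the tail condition. -/
theorem tail_condition_of_compOpNorm_le (h : IsRadialWeight ω)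
    (hC : ∀ r : ℝ, 0 ≤ r → r < 1 → radialTail ω r ≤ C * radialTail ω ((1 + r) / 2))
    (hC1 : 1 ≤ C) (h0 : 0 < radialTail ω 0) {p : ℝ} (hp : 0 < p) {n : ℕ}
    (hn : 4 * (C : ℝ) ≤ 2 ^ (n * p)) {N : ℝ≥0} {r t : ℝ} (hr : 0 ≤ r) (hrt : r ≤ t) (ht : t < 1)
    (hN : compOpNorm p ω (discAut r) ^ p ≤ N / (radialTail ω r * ENNReal.ofReal (1 - r))) :
    radialTail ω ((t - r) / (1 - t * r)) ≤
      (8 * C ^ 2 * N / Real.toNNReal (((1 / 6 : ℝ) ^ n) ^ p * π⁻¹) : ℝ≥0) *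
        (radialTail ω t / radialTail ω r) := by
  have ht0 := hr.trans hrt
  have hr1 : r < 1 := hrt.trans_lt ht
  have htr : 0 < 1 - t * r := by nlinarith
  have hC0 : (C : ℝ≥0∞) ≠ 0 := by
    have := one_pos.trans_le hC1
    exact_mod_cast this.ne'
  have h1 := bergmanNorm_comp_rpow_le_mul_compOpNorm (φ := discAut r) hp
    (differentiableOn_testFunction n ht0 ht)
    (mul_ne_zero (mul_ne_zero (by norm_num) hC0)
      (mul_ne_zero (by simpa using ht) (radialTail_pos hC h0 ht).ne'))
    (ENNReal.mul_ne_top (ENNReal.mul_ne_top (by simp) (by simp))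
      (ENNReal.mul_ne_top ENNReal.ofReal_ne_top (radialTail_lt_top h hC ht0).ne))
    (bergmanNorm_testFunction_rpow_le h hC hC1 hp hn ht0 ht)
  have h2 := le_bergmanNorm_testFunction_comp_discAut h hC hp n hr hrt ht
  have hTr := (radialTail_pos hC h0 hr1).ne'
  have hTrt := (radialTail_lt_top h hC hr).ne
  have hTt := (radialTail_lt_top h hC ht0).ne
  set s := (t - r) / (1 - t * r) with hs
  have hs0 : 0 ≤ s := div_nonneg (by linarith) htr.le
  have hTs := (radialTail_lt_top h hC hs0).ne
  set κ := ((1 / 6 : ℝ) ^ n) ^ p * π⁻¹ with hκ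
  have hκ0 : 0 < κ := by positivity
  -- This cancels the factor (1-t)/(1-r) that comes from the norm of the test function and the
  -- assumed operator bound, leaving a relation between tails alone.
  have hgap : (1 - t) / (1 - r) ≤ 1 - s := by
    have h3 : 1 - s = (1 - t) * (1 + r) / (1 - t * r) := by
      rw [hs]; field_simp; ring
    rw [h3, div_le_div_iff₀ (by linarith) htr]
    have : 1 - t * r ≤ (1 + r) * (1 - r) := by nlinarith
    nlinarith
  have h3 : ENNReal.ofReal (κ * ((1 - t) / (1 - r))) * radialTail ω s ≤
      C * (8 * C * (ENNReal.ofReal (1 - t) * radialTail ω t) *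
        (N / (radialTail ω r * ENNReal.ofReal (1 - r)))) := by
    refine le_trans ?_ (h2.trans (by gcongr; exact h1.trans (by gcongr)))
    refine mul_le_mul_left (ENNReal.ofReal_le_ofReal ?_) _
    rw [hκ, mul_assoc]
    gcongr
  have h4 : N / (radialTail ω r * ENNReal.ofReal (1 - r)) ≠ ∞ :=
    ENNReal.div_ne_top (by simp) (mul_ne_zero hTr (by simpa using hr1))
  lift radialTail ω s to ℝ≥0 using hTs with Ts
  lift radialTail ω t to ℝ≥0 using hTt with Tt
  lift radialTail ω r to ℝ≥0 using hTrt with Tr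
  have hTr0 : Tr ≠ 0 := by simpa using hTr
  have hTr0' : (0 : ℝ) < Tr := by positivity
  rw [ENNReal.ofReal, ENNReal.ofReal, ENNReal.ofReal] at h3
  have hr0 : Real.toNNReal (1 - r) ≠ 0 := by simpa using hr1
  have hκ' : Real.toNNReal κ ≠ 0 := by simpa using hκ0
  rw [← ENNReal.coe_mul (x := Tr), ← ENNReal.coe_div (mul_ne_zero hTr0 hr0)] at h3
  rw [← ENNReal.coe_div hTr0]
  norm_cast at h3 ⊢
  rw [← NNReal.coe_le_coe] at h3 ⊢
  push_cast at h3 ⊢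
  rw [Real.coe_toNNReal _ (by have := sub_pos.2 ht; have := sub_pos.2 hr1; positivity),
    Real.coe_toNNReal _ (by linarith), Real.coe_toNNReal _ (by linarith)] at h3
  rw [Real.coe_toNNReal _ hκ0.le]
  have ht' := sub_pos.2 ht
  have hr' := sub_pos.2 hr1
  have h5 : κ * ((1 - t) / (1 - r)) * Ts * ((1 - r) / ((1 - t) * κ)) ≤
      C * (8 * C * ((1 - t) * Tt) * (N / (Tr * (1 - r)))) * ((1 - r) / ((1 - t) * κ)) := by
    gcongr
  calc (Ts : ℝ) = κ * ((1 - t) / (1 - r)) * Ts * ((1 - r) / ((1 - t) * κ)) := by field_simp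
    _ ≤ _ := h5
    _ = _ := by field_simp

end Doubling

/-! ### Sufficiency of the tail condition -/

theorem norm_discAut_ofReal {r t : ℝ} (hr : 0 ≤ r) (hrt : r ≤ t) (ht : t < 1) :
    ‖discAut (t : ℂ) (r : ℂ)‖ = (t - r) / (1 - t * r) := by
  have htr : 0 < 1 - t * r := by nlinarith
  rw [discAut, Complex.conj_ofReal, ← Complex.ofReal_mul, ← Complex.ofReal_sub,
    ← Complex.ofReal_one, ← Complex.ofReal_sub, ← Complex.ofReal_div, Complex.norm_real,
    Real.norm_of_nonneg (div_nonneg (by linarith) htr.le)]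

/-- The upper bound for composition operators under the tail condition. -/
theorem compOpNorm_rpow_le_of_tail_condition {ω : ℂ → ℝ} {C : ℝ≥0} (h : IsRadialWeight ω)
    (hC : ∀ r : ℝ, 0 ≤ r → r < 1 → radialTail ω r ≤ C * radialTail ω ((1 + r) / 2))
    (h0 : 0 < radialTail ω 0) {p : ℝ} (hp : 0 < p) {M : ℝ≥0}
    (hM : ∀ r t : ℝ, 0 ≤ r → r ≤ t → t < 1 →
      radialTail ω ((t - r) / (1 - t * r)) ≤ M * (radialTail ω t / radialTail ω r))
    {φ : ℂ → ℂ} (hφ : IsAnalyticSelfMap φ) :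
    compOpNorm p ω φ ^ p ≤ (8 * C ^ 2 * (M + (radialTail ω 0).toNNReal) : ℝ≥0) /
      (radialTail ω ‖φ 0‖ * ENNReal.ofReal (1 - ‖φ 0‖)) := by
  have hb : ‖φ 0‖ < 1 := by simpa using hφ.2 (mem_ball_self one_pos)
  have hb0 := norm_nonneg (φ 0)
  have hT := (radialTail_pos hC h0 hb).ne'
  have hTt := (radialTail_lt_top h hC hb0).ne
  have h0t := (radialTail_zero_lt_top h hC).ne
  have hδ : ENNReal.ofReal (1 - ‖φ 0‖) ≠ 0 := by simpa using hb
  -- For x ≥ |φ(0)| this is the tail condition; for smaller x the left side is ω̂(0), and ω̂(|φ(0)|)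
  -- ≤ ω̂(x) suffices. Hence the sum M + ω̂(0).
  have hD : ∀ x ∈ Ico (0 : ℝ) 1,
      radialTail ω (max 0 ((x - ‖φ 0‖) / (1 - ‖φ 0‖ * x))) ≤
        (M + radialTail ω 0) / radialTail ω ‖φ 0‖ * radialTail ω x := by
    intro x hx
    have hax : 0 < 1 - ‖φ 0‖ * x := by nlinarith [hx.1, hx.2]
    rw [ENNReal.div_eq_inv_mul]
    rcases le_or_gt ‖φ 0‖ x with hax' | hxa
    · have h1 := hM ‖φ 0‖ x hb0 hax' hx.2
      rw [max_eq_right (div_nonneg (by linarith) hax.le), mul_comm ‖φ 0‖ x]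
      refine h1.trans ?_
      rw [ENNReal.div_eq_inv_mul, mul_left_comm, mul_assoc]
      gcongr
      exact le_self_add
    · rw [max_eq_left (div_nonpos_of_nonpos_of_nonneg (by linarith) hax.le)]
      calc radialTail ω 0
          = (radialTail ω ‖φ 0‖)⁻¹ * radialTail ω 0 * radialTail ω ‖φ 0‖ := by
            rw [mul_right_comm, ENNReal.inv_mul_cancel hT hTt, one_mul]
        _ ≤ _ := by
            gcongr
            · exact le_add_self
            · exact radialTail_anti ω hxa.le
  refine (compOpNorm_rpow_le hp fun f hf => bergmanNorm_comp_rpow_le h hC hp hφ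
    (ENNReal.div_ne_top (by simp [h0t]) hT) hD hf).trans_eq ?_
  rw [ENNReal.ofReal_div_of_pos (by linarith), ENNReal.div_eq_inv_mul, ENNReal.div_eq_inv_mul,
    ENNReal.div_eq_inv_mul, ENNReal.mul_inv (Or.inl hT) (Or.inl hTt)]
  push_cast
  rw [ENNReal.coe_toNNReal h0t, ENNReal.ofReal_ofNat]
  ring

end

/-! ### Assembly of the theorem -/

theorem mainTheorem10 (p : ℝ) (hp : 0 < p) (ω : ℂ → ℝ) (hω : InDHat ω)
    (hω0 : 0 < radialTail ω 0) :
    (∀ φ : ℂ → ℂ, IsAnalyticSelfMap φ → CompBounded p ω φ) ∧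
    (∃ c : ℝ≥0, 0 < c ∧ ∀ φ : ℂ → ℂ, IsAnalyticSelfMap φ →
      (c : ℝ≥0∞) / (radialTail ω ‖φ 0‖ * ENNReal.ofReal (1 - ‖φ 0‖)) ≤
        compOpNorm p ω φ ^ p) ∧
    ((∃ C : ℝ≥0, 0 < C ∧ ∀ φ : ℂ → ℂ, IsAnalyticSelfMap φ →
      compOpNorm p ω φ ^ p ≤
        (C : ℝ≥0∞) / (radialTail ω ‖φ 0‖ * ENNReal.ofReal (1 - ‖φ 0‖))) ↔
     (∃ M : ℝ≥0, 0 < M ∧ ∀ r t : ℝ, 0 ≤ r → r ≤ t → t < 1 →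
      radialTail ω ‖discAut (t : ℂ) (r : ℂ)‖ ≤
        (M : ℝ≥0∞) * (radialTail ω t / radialTail ω r))) := by
  have h := hω.toIsRadialWeight
  obtain ⟨C, hC1, hC⟩ : ∃ C : ℝ≥0, 1 ≤ C ∧ ∀ r : ℝ, 0 ≤ r → r < 1 →
      radialTail ω r ≤ C * radialTail ω ((1 + r) / 2) := by
    obtain ⟨C, hC⟩ := hω.doubling
    refine ⟨max C 1, le_max_right _ _, fun r h0 h1 => (hC r h0 h1).trans ?_⟩
    gcongr
    exact le_max_left _ _
  have hC0 : (C : ℝ≥0∞) ≠ 0 := by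
    have := one_pos.trans_le hC1
    exact_mod_cast this.ne'
  obtain ⟨n, hn⟩ : ∃ n : ℕ, 4 * (C : ℝ) ≤ 2 ^ (n * p) := by
    obtain ⟨n, hn⟩ := pow_unbounded_of_one_lt (4 * (C : ℝ))
      (Real.one_lt_rpow (one_lt_two (α := ℝ)) hp)
    refine ⟨n, hn.le.trans_eq ?_⟩
    rw [← Real.rpow_natCast, ← Real.rpow_mul (by norm_num), mul_comm]
  have hhalf0 := (radialTail_pos hC hω0 (show (1 / 2 : ℝ) < 1 by norm_num)).ne'
  have hhalft := (radialTail_lt_top h hC (show (0 : ℝ) ≤ 1 / 2 by norm_num)).ne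
  refine ⟨fun φ hφ => ?_, ?_, ?_, ?_⟩
  · have hb : ‖φ 0‖ < 1 := by simpa using hφ.2 (mem_ball_self one_pos)
    obtain ⟨D, hD⟩ := exists_tail_comparison hC (norm_nonneg (φ 0)) hb
    refine compBounded_of_rpow_le hp hφ ?_ fun f hf =>
      bergmanNorm_comp_rpow_le h hC hp hφ ENNReal.coe_ne_top hD hf
    exact ENNReal.mul_ne_top ENNReal.ofReal_ne_top (ENNReal.mul_ne_top (by simp) (by simp))
  · have hκ : 0 < ((1 / 2 : ℝ) ^ n) ^ p := by positivity
    set c : ℝ≥0∞ := ENNReal.ofReal (((1 / 2 : ℝ) ^ n) ^ p) * radialTail ω (1 / 2) / (8 * C) with hc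
    have hc0 : c ≠ 0 := ENNReal.div_ne_zero.2
      ⟨mul_ne_zero (by simpa using hκ) hhalf0, ENNReal.mul_ne_top (by simp) (by simp)⟩
    have hct : c ≠ ∞ := ENNReal.div_ne_top (ENNReal.mul_ne_top ENNReal.ofReal_ne_top hhalft)
      (mul_ne_zero (by norm_num) hC0)
    refine ⟨c.toNNReal, ENNReal.toNNReal_pos hc0 hct, fun φ hφ => ?_⟩
    rw [ENNReal.coe_toNNReal hct]
    have h1 := le_compOpNorm_rpow h hC hC1 hω0 hp hn hφ
    refine ENNReal.div_le_of_le_mul' ?_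
    rw [hc]
    refine ENNReal.div_le_of_le_mul' (h1.trans_eq ?_)
    ring
  · rintro ⟨N, hN0, hN⟩
    have hκ : 0 < Real.toNNReal (((1 / 6 : ℝ) ^ n) ^ p * Real.pi⁻¹) := by
      rw [Real.toNNReal_pos]; positivity
    have hCpos : 0 < C := one_pos.trans_le hC1
    refine ⟨8 * C ^ 2 * N / Real.toNNReal (((1 / 6 : ℝ) ^ n) ^ p * Real.pi⁻¹), by positivity,
      fun r t hr hrt ht => ?_⟩
    rw [norm_discAut_ofReal hr hrt ht]
    have hrn : ‖(r : ℂ)‖ = r := by rw [Complex.norm_real, Real.norm_of_nonneg hr]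
    -- Necessity uses the bound only for the automorphisms φ_r, for which φ_r(0) = r.
    have h1 := hN (discAut r) (isAnalyticSelfMap_discAut (by rw [hrn]; linarith))
    have h2 : discAut (r : ℂ) 0 = r := by simp [discAut]
    rw [h2, hrn] at h1
    exact tail_condition_of_compOpNorm_le h hC hC1 hω0 hp hn hr hrt ht h1
  · rintro ⟨M, hM0, hM⟩
    have hCpos : 0 < C := one_pos.trans_le hC1
    refine ⟨8 * C ^ 2 * (M + (radialTail ω 0).toNNReal), by positivity, fun φ hφ =>
      compOpNorm_rpow_le_of_tail_condition h hC hω0 hp (fun r t hr hrt ht => ?_) hφ⟩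
    rw [← norm_discAut_ofReal hr hrt ht]
    exact hM r t hr hrt ht
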